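/- A pushdown automaton (PDA) $M=(Q,\Sigma,\Gamma,\delta,q_0,Z_0,F)$ accepts $w\in\Sigma^*$ if some computation starting in state $q_0$ with input $w$ and stack content $Z_0$ scans all of $w$ and ends in a state of $F$; $T(M)$ is the set of accepted words. $M$ is in normal form if every move leaves the stack unchanged, pops the topmost symbol or pushes exactly one symbol, moves that consume an input letter leave the stack unchanged, $Z_0$ is never pushed or popped, and every accepting computation ends with stack content $Z_0$. A sequence of configurations $c_0\vdash\dots\vdash c_n$ with stack heights $f_0,\dots,f_n$ is one-turn if $f_0\le\dots\le f_i<f_{i+1}\le\dots\le f_j>f_{j+1}\ge\dots\ge f_n$ for some $0\le i<j<n$. For $k\ge 1$ a sequence is $k$-turn if there are indices $0=s_0<s_1<\dots<s_l=n$ with $l\le k$ such that each $c_{s_j}\vdash\dots\vdash c_{s_{j+1}}$ is one-turn; it is $0$-turn if its stack height is constant. $M$ is a $k$-turn PDA if every $w\in T(M)$ is accepted by a computation that is $k$-turn. A context-free grammar is in Chomsky normal form if all its productions have the form $A\to BC$ or $A\to a$ with variables $A,B,C$ and a terminal $a$. **Theorem.** There is an absolute constant $K$, and for every $m\ge 1$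 there is a constant $C$ depending only on $m$, such that the following holds. Let $\Sigma=\{a_1,\dots,a_m\}$ and let $G$ be a context-free grammar over $\Sigma$ in Chomsky normal form with $h$ variables that generates a language $L(G)\subseteq a_1^*a_2^*\cdots a_m^*$. Then there is an $(m-1)$-turn PDA $M$ in normal form with $T(M)=L(G)$ that has at most $2^{Ch}$ states and at most $K$ stack symbols. (That is, for fixed $m$, $M$ has $2^{O(h)}$ states and $O(1)$ stack symbols.) -/

import Mathlib

/-- A context-free grammar is in Chomsky normal form if each of its productions has the form
`A → B C` or `A → a`, with `A`, `B`, `C` variables and `a` a terminal. -/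
def ContextFreeGrammar.IsChomskyNormalForm {α : Type*} (G : ContextFreeGrammar α) : Prop :=
  ∀ r ∈ G.rules,
    (∃ B C : G.NT, r.output = [Symbol.nonterminal B, Symbol.nonterminal C]) ∨
      ∃ a : α, r.output = [Symbol.terminal a]

/-- The language `a₁^* a₂^* ⋯ a_m^*` over the ordered alphabet `{a₁, …, a_m}`, whose letters are
represented by the elements of `Fin m`. -/
def letterBoundedWords (m : ℕ) : Language (Fin m) :=
  {w | ∃ e : Fin m → ℕ, w = (List.finRange m).flatMap fun i => List.replicate (e i) i}

/-- A (nondeterministic) pushdown automaton with input alphabet `α`, states `Q` and stack symbols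
`Γ`. `(p, β) ∈ δ q (some a) Z` is a move that consumes the letter `a`, and `(p, β) ∈ δ q none Z` is
a move that consumes no input; in both cases the topmost stack symbol `Z` is replaced by `β`. -/
structure PDA (α Q Γ : Type*) where
  δ : Q → Option α → Γ → Set (Q × List Γ)
  finite_δ : ∀ q a Z, (δ q a Z).Finite
  start : Q
  bottom : Γ
  final : Set Q

/-- A configuration `(q, w, γ)`: the current state, the unread part of the input, and the content
of the pushdown store with its topmost symbol first. -/
structure PDA.Config (α Q Γ : Type*) where
  state : Q
  input : List α
  stack : List Γ

namespace PDA

variable {α Q Γ : Type*}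

/-- One computation step `c ⊢ c'`. -/
inductive Step (M : PDA α Q Γ) : Config α Q Γ → Config α Q Γ → Prop
  | read {q p : Q} {a : α} {w : List α} {Z : Γ} {β γ : List Γ} (h : (p, β) ∈ M.δ q (some a) Z) :
      Step M ⟨q, a :: w, Z :: γ⟩ ⟨p, w, β ++ γ⟩
  | eps {q p : Q} {w : List α} {Z : Γ} {β γ : List Γ} (h : (p, β) ∈ M.δ q none Z) :
      Step M ⟨q, w, Z :: γ⟩ ⟨p, w, β ++ γ⟩

/-- `M.Computation n c w` means that `c 0 ⊢ c 1 ⊢ ⋯ ⊢ c n` is a computation of `M` that starts in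
the initial configuration on the input `w`. -/
def Computation (M : PDA α Q Γ) (n : ℕ) (c : ℕ → Config α Q Γ) (w : List α) : Prop :=
  c 0 = ⟨M.start, w, [M.bottom]⟩ ∧ ∀ t < n, M.Step (c t) (c (t + 1))

/-- `M.Accepting n c w` means that `c 0 ⊢ c 1 ⊢ ⋯ ⊢ c n` is a computation of `M` on the input `w`
that ends in a final state with the whole input scanned. -/
def Accepting (M : PDA α Q Γ) (n : ℕ) (c : ℕ → Config α Q Γ) (w : List α) : Prop :=
  M.Computation n c w ∧ (c n).state ∈ M.final ∧ (c n).input = []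

/-- The language `T(M)` accepted by `M` with final states. -/
def language (M : PDA α Q Γ) : Language α :=
  {w | ∃ (n : ℕ) (c : ℕ → Config α Q Γ), M.Accepting n c w}

/-- The normal form of pushdown automata. -/
structure IsNormalForm (M : PDA α Q Γ) : Prop where
  /-- Every move leaves the stack unchanged, pops the topmost symbol, or pushes exactly one
  symbol; the start symbol is never popped and never pushed. -/
  stack_op : ∀ q a Z, ∀ x ∈ M.δ q a Z,
    x.2 = [Z] ∨ (x.2 = [] ∧ Z ≠ M.bottom) ∨ ∃ B, B ≠ M.bottom ∧ x.2 = [B, Z]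
  /-- A move that consumes an input letter leaves the stack unchanged. -/
  read_op : ∀ q a Z, ∀ x ∈ M.δ q (some a) Z, x.2 = [Z]
  /-- At acceptance the pushdown store contains only the start symbol. -/
  accept_bottom : ∀ n c w, M.Accepting n c w → (c n).stack = [M.bottom]

/-- The sequence of stack heights `f a, f (a + 1), …, f b` is one-turn:
`f a ≤ ⋯ ≤ f i < f (i + 1) ≤ ⋯ ≤ f j > f (j + 1) ≥ ⋯ ≥ f b` for some `a ≤ i < j < b`. -/
def OneTurn (f : ℕ → ℕ) (a b : ℕ) : Prop :=
  ∃ i j : ℕ, a ≤ i ∧ i < j ∧ j < b ∧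
    MonotoneOn f (Set.Icc a i) ∧ f i < f (i + 1) ∧ MonotoneOn f (Set.Icc (i + 1) j) ∧
    f (j + 1) < f j ∧ AntitoneOn f (Set.Icc (j + 1) b)

/-- The sequence of stack heights `f 0, …, f n` is `k`-turn: it is divided by indices
`0 = s 0, …, s l = n`, where `l ≤ k`, into one-turn subsequences. For `k = 0` such a
division exists only if `n = 0`; a `0`-turn sequence is one in which the height never changes. -/
def KTurn (k : ℕ) (f : ℕ → ℕ) (n : ℕ) : Prop :=
  (k = 0 ∧ ∀ t ≤ n, f t = f 0) ∨
    ∃ l ≤ k, ∃ s : ℕ → ℕ, s 0 = 0 ∧ s l = n ∧ ∀ j < l, OneTurn f (s j) (s (j + 1))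

/-- `M` is a `k`-turn pushdown automaton: every word in `T(M)` is accepted by a computation whose
sequence of configurations is `k`-turn. -/
def IsKTurn (M : PDA α Q Γ) (k : ℕ) : Prop :=
  ∀ w ∈ M.language, ∃ (n : ℕ) (c : ℕ → Config α Q Γ),
    M.Accepting n c w ∧ KTurn k (fun t => (c t).stack.length) n

end PDA

/-!
The Parikh image of `L(G)` is a union of semilinear sets whose periods belong to pairs of letters
that do not cross, and a pushdown automaton with few turns can store such periods on its stack.

*Grammar.* For a set `X` of variables, call a derivation `A ⇒* u A v` with `A ∈ X` that uses only
variables of `X` a loop over `X`. A loop over the exact variable set `X` of a parse tree can be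
inserted in that tree without changing `X`. Conversely, loops of length at most `2 ^ (h + 1)` can be
removed from a parse tree until its yield is short. Putting back those that enlarge the variable
set, fewer than `h` of them, gives a tree with variable set `X` and a yield of length at most
`h * 2 ^ (h + 1)`, from which the given tree differs, up to Parikh vectors, by a sum of short loops
over `X` (`ContextFreeGrammar.Yields.exists_small`). So the Parikh image is the union over pairs
`(X, c)` of the sets `c + ⟨short loops over X⟩`, and there are only `2 ^ O(h)` such pairs. Tracking
one set `X`, instead of the order in which variables come up, is what keeps this number small.

If all words of `L(G)` are sorted, then passing twice through a loop shows that `u` and `v` are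
powers of letters `l ≤ r` (`IsLoop.letters`), and inserting two loops over `X` in the same tree
shows that their pairs `(l, r)` do not cross (`IsLoop.noncrossing`).

*Automaton.* It guesses `(X, c)` and treats the letters in order. For a letter `t` it reads the
constant `c t`, pops one counter symbol for each occurrence of `t` that is due, and then passes
through loops `t ^ i ⋯ v ^ j`, reading `t ^ i` and pushing `j` counter symbols. The number of
separators on the stack tells with which letter `v` the topmost counter symbols will be matched, so
three stack symbols suffice. Soundness is an invariant on Parikh vectors (`LoopSystem.Invariant`):
a sorted word is determined by its Parikh vector. For completeness, noncrossing makes it possible to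
do all pops for a letter before all pushes, so that the stack turns only between adjacent letters
(`LoopSystem.exists_turns`). A separator is pushed and popped between any two adjacent letters, so
that exactly `m - 1` turns occur and none of them is degenerate.
-/

/-! ### Parse trees and loops -/

/-- The Parikh vector of a word: how often each letter occurs in it. -/
def parikh {α : Type*} [DecidableEq α] (w : List α) : α → ℕ := fun a => w.count a

theorem parikh_nil {α : Type*} [DecidableEq α] : parikh ([] : List α) = 0 := by
  funext a; simp [parikh]

theorem parikh_append {α : Type*} [DecidableEq α] (u v : List α) :
    parikh (u ++ v) = parikh u + parikh v := by
  funext a; simp [parikh]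

namespace ContextFreeGrammar

variable {α : Type*} {G : ContextFreeGrammar α} [DecidableEq G.NT]

/-- `G.Yields A X w`: some parse tree of `G` has root `A` and yield `w`, and `X` is the set of
all variables that label its nodes. Only productions in Chomsky normal form are considered. -/
inductive Yields (G : ContextFreeGrammar α) [DecidableEq G.NT] :
    G.NT → Finset G.NT → List α → Prop
  | leaf {A : G.NT} {a : α} (h : ⟨A, [Symbol.terminal a]⟩ ∈ G.rules) : Yields G A {A} [a]
  | node {A B C : G.NT} {X Y : Finset G.NT} {u v : List α}
      (h : ⟨A, [Symbol.nonterminal B, Symbol.nonterminal C]⟩ ∈ G.rules)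
      (hB : Yields G B X u) (hC : Yields G C Y v) : Yields G A (insert A (X ∪ Y)) (u ++ v)

/-- `G.Context A B X u v`: some parse tree of `G` with root `A`, variable set `X` and yield `u B v`
has all its leaves labelled by terminals but one, which is labelled by the variable `B`. -/
inductive Context (G : ContextFreeGrammar α) [DecidableEq G.NT] :
    G.NT → G.NT → Finset G.NT → List α → List α → Prop
  | hole (A : G.NT) : Context G A A {A} [] []
  | left {A B C D : G.NT} {X Y : Finset G.NT} {u v w : List α}
      (h : ⟨A, [Symbol.nonterminal B, Symbol.nonterminal C]⟩ ∈ G.rules)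
      (hB : Context G B D X u v) (hC : Yields G C Y w) :
      Context G A D (insert A (X ∪ Y)) u (v ++ w)
  | right {A B C D : G.NT} {X Y : Finset G.NT} {u v w : List α}
      (h : ⟨A, [Symbol.nonterminal B, Symbol.nonterminal C]⟩ ∈ G.rules)
      (hB : Yields G B X w) (hC : Context G C D Y u v) :
      Context G A D (insert A (X ∪ Y)) (w ++ u) v

theorem Yields.root_mem {A : G.NT} {X : Finset G.NT} {w : List α} (h : G.Yields A X w) :
    A ∈ X := by
  cases h <;> simp

theorem Yields.length_pos {A : G.NT} {X : Finset G.NT} {w : List α} (h : G.Yields A X w) :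
    0 < w.length := by
  induction h with
  | leaf => simp
  | node _ _ _ ih _ => simp only [List.length_append]; omega

theorem Context.fill {A B : G.NT} {X Y : Finset G.NT} {u v w : List α}
    (h : G.Context A B X u v) (hw : G.Yields B Y w) : G.Yields A (X ∪ Y) (u ++ w ++ v) := by
  induction h with
  | hole A =>
    have := hw.root_mem
    rw [show {A} ∪ Y = Y by ext; simp; rintro rfl; exact this]
    simpa using hw
  | @left A B C D X Z u v t h _ hC ih =>
    have := Yields.node h (ih hw) hC
    convert! this using 1
    · ext; simp; tauto
    · simp
  | @right A B C D X Z u v t h hB _ ih =>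
    have := Yields.node h hB (ih hw)
    convert! this using 1
    · ext; simp
    · simp

theorem Yields.exists_context {A B : G.NT} {X : Finset G.NT} {w : List α}
    (h : G.Yields A X w) (hB : B ∈ X) :
    ∃ X₁ X₂ u z v, G.Context A B X₁ u v ∧ G.Yields B X₂ z ∧ X = X₁ ∪ X₂ ∧ w = u ++ z ++ v := by
  induction h with
  | @leaf A a h =>
    obtain rfl : B = A := by simpa using hB
    exact ⟨{B}, {B}, [], [a], [], .hole B, .leaf h, by simp, by simp⟩
  | @node A C D X Y u v h hC hD ihC ihD =>
    by_cases hA : B = A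
    · subst hA
      exact ⟨{B}, _, [], _, [], .hole B, .node h hC hD, by ext; simp, by simp⟩
    · simp only [Finset.mem_insert, hA, Finset.mem_union, false_or] at hB
      rcases hB with hB | hB
      · obtain ⟨X₁, X₂, x, z, y, h₁, h₂, rfl, rfl⟩ := ihC hB
        exact ⟨_, X₂, _, z, _, .left h h₁ hD, h₂, by ext; simp; tauto, by simp⟩
      · obtain ⟨X₁, X₂, x, z, y, h₁, h₂, rfl, rfl⟩ := ihD hB
        exact ⟨_, X₂, _, z, _, .right h hC h₁, h₂, by ext; simp, by simp⟩

/-- A parse tree without a repeated variable on any path has a short yield. Otherwise, at a lowest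
node whose variable is repeated below it, a short loop starts. -/
theorem Yields.length_le_or_exists_loop [Fintype G.NT] {A : G.NT} {X : Finset G.NT} {w : List α}
    (h : G.Yields A X w) :
    w.length ≤ 2 ^ X.card ∨
      ∃ B X₁ Y X₂ u x z y v, G.Context A B X₁ u v ∧ G.Context B B Y x y ∧ G.Yields B X₂ z ∧
        X = X₁ ∪ Y ∪ X₂ ∧ w = u ++ (x ++ z ++ y) ++ v ∧ 0 < x.length + y.length ∧
        x.length + y.length ≤ 2 ^ (Fintype.card G.NT + 1) := by
  induction h with
  | leaf => left; simp
  | @node A C D X Y u v h hC hD ihC ihD =>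
    rcases ihC with ihC | ⟨B, X₁, Z, X₂, p, x, z, y, q, h₁, h₂, h₃, rfl, rfl, h₄, h₅⟩
    rotate_left
    · exact .inr ⟨B, _, Z, X₂, _, x, z, y, _, .left h h₁ hD, h₂, h₃, by ext; simp; tauto,
        by simp, h₄, h₅⟩
    rcases ihD with ihD | ⟨B, X₁, Z, X₂, p, x, z, y, q, h₁, h₂, h₃, rfl, rfl, h₄, h₅⟩
    rotate_left
    · exact .inr ⟨B, _, Z, X₂, _, x, z, y, _, .right h hC h₁, h₂, h₃, by ext; simp,
        by simp, h₄, h₅⟩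
    have hsum : u.length + v.length ≤ 2 ^ (Fintype.card G.NT + 1) := by
      have h₁ : 2 ^ X.card ≤ 2 ^ Fintype.card G.NT :=
        Nat.pow_le_pow_right (by norm_num) (Finset.card_le_univ _)
      have h₂ : 2 ^ Y.card ≤ 2 ^ Fintype.card G.NT :=
        Nat.pow_le_pow_right (by norm_num) (Finset.card_le_univ _)
      rw [pow_succ]; omega
    have hu := hC.length_pos
    have hv := hD.length_pos
    by_cases hAX : A ∈ X
    · right
      obtain ⟨X₁, X₂, x, z, y, h₁, h₂, rfl, rfl⟩ := hC.exists_context hAX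
      simp only [List.length_append] at hsum
      exact ⟨A, {A}, _, X₂, [], x, z, _, [], .hole A, .left h h₁ hD, h₂, by ext; simp; tauto,
        by simp, by simp; omega, by simp; omega⟩
    by_cases hAY : A ∈ Y
    · right
      obtain ⟨X₁, X₂, x, z, y, h₁, h₂, rfl, rfl⟩ := hD.exists_context hAY
      simp only [List.length_append] at hsum
      exact ⟨A, {A}, _, X₂, [], _, z, _, [], .hole A, .right h hC h₁, h₂, by ext; simp,
        by simp, by simp; omega, by simp; omega⟩
    left
    have hcard : (insert A (X ∪ Y)).card = (X ∪ Y).card + 1 := by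
      rw [Finset.card_insert_of_notMem]; simp [hAX, hAY]
    have h₁ : 2 ^ X.card ≤ 2 ^ (X ∪ Y).card :=
      Nat.pow_le_pow_right (by norm_num) (Finset.card_le_card Finset.subset_union_left)
    have h₂ : 2 ^ Y.card ≤ 2 ^ (X ∪ Y).card :=
      Nat.pow_le_pow_right (by norm_num) (Finset.card_le_card Finset.subset_union_right)
    rw [hcard, pow_succ, List.length_append]
    omega

/-- `G.IsLoop X u v`: there is a derivation `A ⇒* u A v` with `A ∈ X` that uses variables of `X`
only. -/
def IsLoop (G : ContextFreeGrammar α) [DecidableEq G.NT] (X : Finset G.NT) (u v : List α) : Prop :=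
  ∃ A ∈ X, ∃ Y ⊆ X, G.Context A A Y u v

/-- A loop over the variable set of a parse tree can be inserted without changing that set. -/
theorem Yields.insert_loop {S : G.NT} {X : Finset G.NT} {u v w : List α}
    (h : G.Yields S X w) (hl : G.IsLoop X u v) :
    ∃ x z y, w = x ++ z ++ y ∧ G.Yields S X (x ++ (u ++ z ++ v) ++ y) := by
  obtain ⟨A, hA, Y, hY, hl⟩ := hl
  obtain ⟨X₁, X₂, x, z, y, h₁, h₂, rfl, rfl⟩ := h.exists_context hA
  refine ⟨x, z, y, rfl, ?_⟩
  convert! h₁.fill (hl.fill h₂) using 1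
  ext a
  have := @hY a
  simp at this ⊢
  tauto

/-! ### Parikh vectors of the words of a grammar -/

section Parikh

variable [DecidableEq α]

/-- The Parikh vectors of the loops over `X` whose total length is at most `N`. -/
def loopVectors (G : ContextFreeGrammar α) [DecidableEq G.NT] (X : Finset G.NT) (N : ℕ) :
    Set (α → ℕ) :=
  {p | ∃ u v, G.IsLoop X u v ∧ u.length + v.length ≤ N ∧ p = parikh u + parikh v}

theorem Yields.exists_parikh_add {S : G.NT} {X : Finset G.NT} {w : List α} {N : ℕ} {n : α → ℕ}
    (h : G.Yields S X w) (hn : n ∈ AddSubmonoid.closure (G.loopVectors X N)) :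
    ∃ w', G.Yields S X w' ∧ parikh w' = parikh w + n := by
  induction hn using AddSubmonoid.closure_induction generalizing w with
  | mem p hp =>
    obtain ⟨u, v, hl, -, rfl⟩ := hp
    obtain ⟨x, z, y, rfl, h'⟩ := h.insert_loop hl
    exact ⟨_, h', by simp only [parikh_append]; abel⟩
  | zero => exact ⟨w, h, by simp⟩
  | add p q _ _ ihp ihq =>
    obtain ⟨w₁, h₁, e₁⟩ := ihp h
    obtain ⟨w₂, h₂, e₂⟩ := ihq h₁
    exact ⟨w₂, h₂, by rw [e₂, e₁, add_assoc]⟩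

/-- Every parse tree arises from a small one with the same variable set by the insertion of short
loops. The small tree consists of a tree without loops and of those loops whose insertion
enlarges the variable set; there are fewer of these than variables. -/
theorem Yields.exists_small [Fintype G.NT] {A : G.NT} {X : Finset G.NT} {w : List α}
    (h : G.Yields A X w) :
    ∃ w₀, G.Yields A X w₀ ∧ w₀.length ≤ X.card * 2 ^ (Fintype.card G.NT + 1) ∧
      ∃ n ∈ AddSubmonoid.closure (G.loopVectors X (2 ^ (Fintype.card G.NT + 1))),
        parikh w = parikh w₀ + n := by
  induction hw : w.length using Nat.strong_induction_on generalizing X w with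
  | _ k ih =>
    subst hw
    rcases h.length_le_or_exists_loop with
      hle | ⟨B, X₁, Y, X₂, u, x, z, y, v, h₁, h₂, h₃, hX, rfl, hpos, hlen⟩
    · refine ⟨w, h, hle.trans ?_, 0, zero_mem _, by simp⟩
      have h₁ : 2 ^ X.card ≤ 2 ^ (Fintype.card G.NT + 1) :=
        Nat.pow_le_pow_right (by norm_num) ((Finset.card_le_univ _).trans (Nat.le_succ _))
      have h₂ : 0 < X.card := Finset.card_pos.mpr ⟨A, h.root_mem⟩
      nlinarith
    · obtain ⟨w₀, hw₀, hlen₀, n, hn, e⟩ := ih _ (by simp; omega) (h₁.fill h₃) rfl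
      have hB : B ∈ X₁ ∪ X₂ := Finset.mem_union_right _ h₃.root_mem
      have hsub : X₁ ∪ X₂ ⊆ X := by rw [hX]; intro a; simp; tauto
      have hYX : Y ⊆ X := by rw [hX]; intro a; simp; tauto
      have hmono : G.loopVectors (X₁ ∪ X₂) (2 ^ (Fintype.card G.NT + 1)) ⊆
          G.loopVectors X (2 ^ (Fintype.card G.NT + 1)) := by
        rintro _ ⟨u, v, ⟨C, hC, Z, hZ, hl⟩, hN, rfl⟩
        exact ⟨u, v, ⟨C, hsub hC, Z, hZ.trans hsub, hl⟩, hN, rfl⟩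
      have hn' := AddSubmonoid.closure_mono hmono hn
      by_cases hY : Y ⊆ X₁ ∪ X₂
      · have hXe : X = X₁ ∪ X₂ := by
          refine Finset.Subset.antisymm ?_ hsub
          rw [hX]; intro a ha
          have := @hY a
          simp at ha this ⊢
          tauto
        refine ⟨w₀, hXe ▸ hw₀, hXe ▸ hlen₀, n + (parikh x + parikh y), add_mem hn'
          (AddSubmonoid.subset_closure ⟨x, y, ⟨B, hsub hB, Y, hYX, h₂⟩, hlen, rfl⟩), ?_⟩
        simp only [parikh_append] at e ⊢
        rw [← add_assoc (parikh w₀), ← e]; abel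
      · obtain ⟨Z₁, Z₂, p, q, r, g₁, g₂, hZ, rfl⟩ := hw₀.exists_context hB
        refine ⟨p ++ (x ++ q ++ y) ++ r, ?_, ?_, n, hn', ?_⟩
        · convert! g₁.fill (h₂.fill g₂) using 1
          rw [hX]
          ext a
          have := Finset.ext_iff.mp hZ a
          simp at this ⊢
          tauto
        · have hlt : (X₁ ∪ X₂).card < X.card := by
            refine Finset.card_lt_card ⟨hsub, fun hs => hY (hYX.trans hs)⟩
          have := Nat.mul_le_mul_right (2 ^ (Fintype.card G.NT + 1)) hlt
          rw [Nat.succ_mul] at this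
          simp only [List.length_append] at hlen₀ ⊢
          omega
        · simp only [parikh_append] at e ⊢
          have : parikh p + (parikh x + parikh q + parikh y) + parikh r + n =
            (parikh p + parikh q + parikh r + n) + (parikh x + parikh y) := by abel
          rw [this, ← e]; abel

end Parikh

/-! ### Derivations and parse trees -/

section Language

/-- The sentential form `s` derives the word `w` through parse trees for its variables. -/
def FormYields (G : ContextFreeGrammar α) [DecidableEq G.NT] :
    List (Symbol α G.NT) → List α → Prop
  | [], w => w = []
  | Symbol.terminal a :: s, w => ∃ v, w = a :: v ∧ FormYields G s v
  | Symbol.nonterminal A :: s, w =>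
    ∃ X u v, w = u ++ v ∧ G.Yields A X u ∧ FormYields G s v

theorem formYields_append {s t : List (Symbol α G.NT)} {w : List α} :
    G.FormYields (s ++ t) w ↔ ∃ u v, w = u ++ v ∧ G.FormYields s u ∧ G.FormYields t v := by
  induction s generalizing w with
  | nil => simp [FormYields]
  | cons x s ih =>
    cases x with
    | terminal a =>
      simp only [List.cons_append, FormYields, ih]
      constructor
      · rintro ⟨_, rfl, u, v, rfl, hu, hv⟩
        exact ⟨a :: u, v, rfl, ⟨u, rfl, hu⟩, hv⟩
      · rintro ⟨_, v, rfl, ⟨u, rfl, hu⟩, hv⟩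
        exact ⟨u ++ v, rfl, u, v, rfl, hu, hv⟩
    | nonterminal A =>
      simp only [List.cons_append, FormYields, ih]
      constructor
      · rintro ⟨X, p, _, rfl, hp, u, v, rfl, hu, hv⟩
        exact ⟨p ++ u, v, by simp, ⟨X, p, u, rfl, hp, hu⟩, hv⟩
      · rintro ⟨_, v, rfl, ⟨X, p, u, rfl, hp, hu⟩, hv⟩
        exact ⟨X, p, u ++ v, by simp, hp, u, v, rfl, hu, hv⟩

theorem formYields_terminal (w : List α) : G.FormYields (w.map Symbol.terminal) w := by
  induction w with
  | nil => simp [FormYields]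
  | cons a w ih => exact ⟨w, rfl, ih⟩

theorem formYields_of_produces (hG : G.IsChomskyNormalForm) {s t : List (Symbol α G.NT)}
    {w : List α} (h : G.Produces s t) (ht : G.FormYields t w) : G.FormYields s w := by
  obtain ⟨r, hr, hst⟩ := h
  obtain ⟨p, q, rfl, rfl⟩ := hst.exists_parts
  obtain ⟨_, v, rfl, hpo, hv⟩ := formYields_append.mp ht
  obtain ⟨x, y, rfl, hp, ho⟩ := formYields_append.mp hpo
  refine formYields_append.mpr ⟨_, v, rfl, formYields_append.mpr ⟨x, y, rfl, hp, ?_⟩, hv⟩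
  obtain ⟨A, o⟩ := r
  rcases hG _ hr with ⟨B, C, e⟩ | ⟨a, e⟩ <;> dsimp only at e ho <;> subst e
  · obtain ⟨X, u, _, rfl, hu, Y, z, _, rfl, hz, rfl⟩ := ho
    exact ⟨_, u ++ z, [], by simp, .node hr hu hz, rfl⟩
  · obtain ⟨_, rfl, rfl⟩ := ho
    exact ⟨_, [a], [], rfl, .leaf hr, rfl⟩

theorem Yields.derives {A : G.NT} {X : Finset G.NT} {w : List α} (h : G.Yields A X w) :
    G.Derives [Symbol.nonterminal A] (w.map Symbol.terminal) := by
  induction h with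
  | leaf h => exact Produces.single ⟨_, h, ContextFreeRule.Rewrites.input_output⟩
  | @node A B C X Y u v h _ _ ihB ihC =>
    refine Produces.trans_derives ⟨_, h, ContextFreeRule.Rewrites.input_output⟩ ?_
    have h₁ := ihB.append_right [Symbol.nonterminal C]
    have h₂ := ihC.append_left (u.map Symbol.terminal)
    rw [List.map_append]
    exact h₁.trans h₂

theorem mem_language_iff_exists_yields (hG : G.IsChomskyNormalForm) (w : List α) :
    w ∈ G.language ↔ ∃ X, G.Yields G.initial X w := by
  constructor
  · intro h
    have key : G.FormYields [Symbol.nonterminal G.initial] w := by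
      refine Relation.ReflTransGen.head_induction_on (motive := fun s _ => G.FormYields s w)
        ((mem_language_iff G w).mp h) (formYields_terminal w) ?_
      intro s t hst _ ht
      exact formYields_of_produces hG hst ht
    obtain ⟨X, u, _, rfl, hu, rfl⟩ := key
    exact ⟨X, by simpa using hu⟩
  · rintro ⟨X, h⟩
    exact h.derives

end Language

end ContextFreeGrammar

namespace ContextFreeGrammar

variable {α : Type*} {G : ContextFreeGrammar α} [DecidableEq G.NT]

theorem Context.comp {A B C : G.NT} {X Y : Finset G.NT} {u v x y : List α}
    (h : G.Context A B X u v) (h' : G.Context B C Y x y) :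
    ∃ Z ⊆ X ∪ Y, G.Context A C Z (u ++ x) (y ++ v) := by
  induction h with
  | hole A => exact ⟨Y, Finset.subset_union_right, by simpa using h'⟩
  | left h _ hC ih =>
    obtain ⟨Z, hZ, hc⟩ := ih h'
    refine ⟨_, ?_, by simpa using Context.left h hc hC⟩
    intro a
    have := @hZ a
    simp at this ⊢
    tauto
  | right h hB _ ih =>
    obtain ⟨Z, hZ, hc⟩ := ih h'
    refine ⟨_, ?_, by simpa using Context.right h hB hc⟩
    intro a
    have := @hZ a
    simp at this ⊢
    tauto

/-- A loop inserted in a context starts on the path to the hole, to the left of that path, or to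
the right of it. -/
theorem Context.insert_loop {A B D : G.NT} {X Y : Finset G.NT} {u v x y : List α}
    (h : G.Context A B X u v) (hD : D ∈ X) (hl : G.Context D D Y x y) :
    (∃ Z u₁ u₂ v₁ v₂, G.Context A B Z (u₁ ++ x ++ u₂) (v₂ ++ y ++ v₁) ∧
      u = u₁ ++ u₂ ∧ v = v₂ ++ v₁) ∨
    (∃ Z u₁ z u₂, G.Context A B Z (u₁ ++ (x ++ z ++ y) ++ u₂) v) ∨
    ∃ Z v₁ z v₂, G.Context A B Z u (v₂ ++ (x ++ z ++ y) ++ v₁) := by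
  have top : ∀ {A X u v}, G.Context A B X u v → D = A →
      (∃ Z u₁ u₂ v₁ v₂, G.Context A B Z (u₁ ++ x ++ u₂) (v₂ ++ y ++ v₁) ∧
      u = u₁ ++ u₂ ∧ v = v₂ ++ v₁) := by
    rintro A X u v h rfl
    obtain ⟨Z, -, hc⟩ := hl.comp h
    exact ⟨Z, [], u, [], v, by simpa using hc, by simp, by simp⟩
  induction h with
  | hole A => exact .inl (top (.hole A) (by simpa using hD))
  | @left A C E B X W u v w h hB hC ih =>
    by_cases hA : D = A
    · exact .inl (top (.left h hB hC) hA)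
    simp only [Finset.mem_insert, hA, Finset.mem_union, false_or] at hD
    rcases hD with hD | hD
    · rcases ih hD top with ⟨Z, u₁, u₂, v₁, v₂, hc, rfl, rfl⟩ | ⟨Z, u₁, z, u₂, hc⟩ |
        ⟨Z, v₁, z, v₂, hc⟩
      · exact .inl ⟨_, u₁, u₂, v₁ ++ w, v₂, by simpa using Context.left h hc hC, rfl, by simp⟩
      · exact .inr (.inl ⟨_, u₁, z, u₂, Context.left h hc hC⟩)
      · exact .inr (.inr ⟨_, v₁ ++ w, z, v₂, by simpa using Context.left h hc hC⟩)
    · obtain ⟨X₁, X₂, p, z, q, h₁, h₂, -, rfl⟩ := hC.exists_context hD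
      exact .inr (.inr ⟨_, q, z, v ++ p,
        by simpa using Context.left h hB (h₁.fill (hl.fill h₂))⟩)
  | @right A C E B X W u v w h hB hC ih =>
    by_cases hA : D = A
    · exact .inl (top (.right h hB hC) hA)
    simp only [Finset.mem_insert, hA, Finset.mem_union, false_or] at hD
    rcases hD with hD | hD
    · obtain ⟨X₁, X₂, p, z, q, h₁, h₂, -, rfl⟩ := hB.exists_context hD
      exact .inr (.inl ⟨_, p, z, q ++ u,
        by simpa using Context.right h (h₁.fill (hl.fill h₂)) hC⟩)
    · rcases ih hD top with ⟨Z, u₁, u₂, v₁, v₂, hc, rfl, rfl⟩ | ⟨Z, u₁, z, u₂, hc⟩ |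
        ⟨Z, v₁, z, v₂, hc⟩
      · exact .inl ⟨_, w ++ u₁, u₂, v₁, v₂, by simpa using Context.right h hB hc, by simp, rfl⟩
      · exact .inr (.inl ⟨_, w ++ u₁, z, u₂, by simpa using Context.right h hB hc⟩)
      · exact .inr (.inr ⟨_, v₁, z, v₂, Context.right h hB hc⟩)

/-! ### Loops in grammars of letter-bounded languages -/

section Sorted

variable [LinearOrder α] {S : G.NT} {X : Finset G.NT} {w : List α}

/-- In a grammar that generates sorted words only, both sides of a loop are powers of a letter:
otherwise the loop, passed through twice, would produce an unsorted word. -/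
theorem IsLoop.letters (hs : ∀ X w, G.Yields S X w → w.Pairwise (· ≤ ·)) (hw : G.Yields S X w)
    {u v : List α} (hl : G.IsLoop X u v) :
    (∀ a ∈ u, ∀ b ∈ u, a = b) ∧ (∀ a ∈ v, ∀ b ∈ v, a = b) ∧ ∀ a ∈ u, ∀ b ∈ v, a ≤ b := by
  obtain ⟨A, hA, Y, hY, hc⟩ := hl
  obtain ⟨Z, hZ, hcc⟩ := hc.comp hc
  have hl₂ : G.IsLoop X (u ++ u) (v ++ v) := by
    refine ⟨A, hA, Z, hZ.trans ?_, hcc⟩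
    simpa using hY
  obtain ⟨x, z, y, -, h⟩ := hw.insert_loop hl₂
  have hp := hs _ _ h
  simp only [List.pairwise_append, List.mem_append] at hp
  refine ⟨fun a ha b hb => le_antisymm ?_ ?_, fun a ha b hb => le_antisymm ?_ ?_, ?_⟩ <;> grind

/-- Two loops over the variable set of one parse tree do not cross, since both can be inserted in
that tree. -/
theorem IsLoop.noncrossing (hs : ∀ X w, G.Yields S X w → w.Pairwise (· ≤ ·))
    (hw : G.Yields S X w) {u v x y : List α} (hl : G.IsLoop X u v) (hl' : G.IsLoop X x y)
    {l r l' r' : α} (hu : l ∈ u) (hv : r ∈ v) (hx : l' ∈ x) (hy : r' ∈ y)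
    (h₁ : l < l') (h₂ : l' < r) (h₃ : r < r') : False := by
  obtain ⟨A, hA, Y, -, hc⟩ := hl
  obtain ⟨B, hB, Y', -, hc'⟩ := hl'
  obtain ⟨X₁, X₂, p, z, q, g, gz, rfl, -⟩ := hw.exists_context hA
  rcases Finset.mem_union.mp hB with hB | hB
  · rcases g.insert_loop hB hc' with ⟨Z, u₁, u₂, v₁, v₂, g', -, -⟩ | ⟨Z, u₁, t, u₂, g'⟩ |
        ⟨Z, v₁, t, v₂, g'⟩ <;>
    · have hp := hs _ _ (g'.fill (hc.fill gz))
      simp only [List.pairwise_append, List.mem_append] at hp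
      grind
  · obtain ⟨Z₁, Z₂, a, t, b, k, kt, -, rfl⟩ := gz.exists_context hB
    have hp := hs _ _ (g.fill (hc.fill (k.fill (hc'.fill kt))))
    simp only [List.pairwise_append, List.mem_append] at hp
    grind

end Sorted

end ContextFreeGrammar

/-! ### Sorted words -/

theorem pairwise_le_flatMap_replicate {α : Type*} [Preorder α] (e : α → ℕ) {l : List α}
    (hl : l.Pairwise (· ≤ ·)) :
    (l.flatMap fun i => List.replicate (e i) i).Pairwise (· ≤ ·) := by
  induction l with
  | nil => simp
  | cons a l ih =>
    rw [List.pairwise_cons] at hl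
    simp only [List.flatMap_cons, List.pairwise_append, List.mem_flatMap, List.mem_replicate,
      List.pairwise_replicate]
    refine ⟨Or.inr le_rfl, ih hl.2, ?_⟩
    rintro x ⟨_, rfl⟩ y ⟨b, hb, _, rfl⟩
    exact hl.1 _ hb

theorem eq_flatMap_replicate_count {m : ℕ} {w : List (Fin m)} (h : w.Pairwise (· ≤ ·)) :
    w = (List.finRange m).flatMap fun i => List.replicate (w.count i) i := by
  refine List.Perm.eq_of_pairwise (fun a b _ _ => le_antisymm) h
    (pairwise_le_flatMap_replicate _ (List.pairwise_le_finRange m)) ?_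
  rw [List.perm_iff_count]
  intro a
  rw [List.count_flatMap]
  simp [List.count_replicate, Function.comp_def, ← Fin.sum_univ_def]

theorem mem_letterBoundedWords_iff {m : ℕ} {w : List (Fin m)} :
    w ∈ letterBoundedWords m ↔ w.Pairwise (· ≤ ·) := by
  constructor
  · rintro ⟨e, rfl⟩
    exact pairwise_le_flatMap_replicate e (List.pairwise_le_finRange m)
  · exact fun h => ⟨_, eq_flatMap_replicate_count h⟩

/-! ### Turns of a sequence -/

section Turns

variable {X : Type*} {R : X → X → Prop} {ht : X → ℕ}

/-- `Climbs R ht a b`: a sequence of `R`-steps leads from `a` to `b` along which the height `ht`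
never decreases. -/
def Climbs (R : X → X → Prop) (ht : X → ℕ) : X → X → Prop :=
  Relation.ReflTransGen fun a b => R a b ∧ ht a ≤ ht b

/-- `Descends R ht a b`: a sequence of `R`-steps leads from `a` to `b` along which the height `ht`
never increases. -/
def Descends (R : X → X → Prop) (ht : X → ℕ) : X → X → Prop :=
  Relation.ReflTransGen fun a b => R a b ∧ ht b ≤ ht a

/-- `Levels R ht a b`: a sequence of `R`-steps leads from `a` to `b` along which the height `ht`
does not change. -/
def Levels (R : X → X → Prop) (ht : X → ℕ) : X → X → Prop :=
  Relation.ReflTransGen fun a b => R a b ∧ ht a = ht b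

theorem Levels.climbs {a b : X} (h : Levels R ht a b) : Climbs R ht a b :=
  Relation.ReflTransGen.mono (fun _ _ h => ⟨h.1, h.2.le⟩) _ _ h

theorem Levels.descends {a b : X} (h : Levels R ht a b) : Descends R ht a b :=
  Relation.ReflTransGen.mono (fun _ _ h => ⟨h.1, h.2.ge⟩) _ _ h

theorem Climbs.le {a b : X} (h : Climbs R ht a b) : ht a ≤ ht b := by
  induction h with
  | refl => exact le_rfl
  | tail _ h ih => exact ih.trans h.2

theorem Descends.le {a b : X} (h : Descends R ht a b) : ht b ≤ ht a := by
  induction h with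
  | refl => exact le_rfl
  | tail _ h ih => exact h.2.trans ih

theorem Climbs.levels {a b : X} (h : Climbs R ht a b) (hab : ht b ≤ ht a) : Levels R ht a b := by
  induction h with
  | refl => exact .refl
  | tail h₁ h₂ ih =>
    have := Climbs.le h₁
    exact (ih (h₂.2.trans hab)).tail ⟨h₂.1, by have := h₂.2; omega⟩

theorem exists_seq_of_reflTransGen {S : X → X → Prop} {a b : X}
    (h : Relation.ReflTransGen S a b) :
    ∃ (n : ℕ) (f : ℕ → X), f 0 = a ∧ f n = b ∧ ∀ t < n, S (f t) (f (t + 1)) := by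
  induction h with
  | refl => exact ⟨0, fun _ => a, rfl, rfl, by simp⟩
  | @tail b c _ hbc ih =>
    obtain ⟨n, f, h₀, hn, hs⟩ := ih
    refine ⟨n + 1, fun t => if t ≤ n then f t else c, by simpa using h₀, by simp, ?_⟩
    intro t ht
    rcases Nat.lt_or_ge t n with h | h
    · simpa [h.le, Nat.succ_le_of_lt h] using hs t h
    · obtain rfl : t = n := by omega
      simpa [hn] using hbc

theorem exists_last_index {P : ℕ → Prop} {a b : ℕ} (hab : a ≤ b) (ha : P a) :
    ∃ i, a ≤ i ∧ i ≤ b ∧ P i ∧ ∀ k, i < k → k ≤ b → ¬ P k := by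
  induction b, hab using Nat.le_induction with
  | base => exact ⟨a, le_rfl, le_rfl, ha, fun k _ _ => by omega⟩
  | succ b hab ih =>
    by_cases hP : P (b + 1)
    · exact ⟨b + 1, by omega, le_rfl, hP, fun k _ _ => by omega⟩
    · obtain ⟨i, h₁, h₂, h₃, h₄⟩ := ih
      refine ⟨i, h₁, by omega, h₃, fun k hk hkb => ?_⟩
      rcases hkb.eq_or_lt with rfl | h
      · exact hP
      · exact h₄ k hk (by omega)

namespace PDA

theorem OneTurn.lt {f : ℕ → ℕ} {a b : ℕ} (h : OneTurn f a b) : a < b := by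
  obtain ⟨i, j, h₁, h₂, h₃, -⟩ := h
  omega

theorem OneTurn.congr {f g : ℕ → ℕ} {a b : ℕ} (h : OneTurn f a b)
    (hfg : ∀ t ∈ Set.Icc a b, f t = g t) : OneTurn g a b := by
  obtain ⟨i, j, h₁, h₂, h₃, h₄, h₅, h₆, h₇, h₈⟩ := h
  refine ⟨i, j, h₁, h₂, h₃, ?_, ?_, ?_, ?_, ?_⟩
  · exact h₄.congr fun t ht => hfg t ⟨ht.1, by have := ht.2; omega⟩
  · rwa [← hfg i ⟨by omega, by omega⟩, ← hfg (i + 1) ⟨by omega, by omega⟩]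
  · exact h₆.congr fun t ht => hfg t ⟨by have := ht.1; omega, by have := ht.2; omega⟩
  · rwa [← hfg j ⟨by omega, by omega⟩, ← hfg (j + 1) ⟨by omega, by omega⟩]
  · exact h₈.congr fun t ht => hfg t ⟨by have := ht.1; omega, ht.2⟩

theorem oneTurn_shift {f : ℕ → ℕ} {a b k : ℕ} (h : OneTurn (fun t => f (k + t)) a b) :
    OneTurn f (k + a) (k + b) := by
  obtain ⟨i, j, h₁, h₂, h₃, h₄, h₅, h₆, h₇, h₈⟩ := h
  refine ⟨k + i, k + j, by omega, by omega, by omega, ?_, h₅, ?_, h₇, ?_⟩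
  all_goals
    intro x hx y hy hxy
    rw [Set.mem_Icc] at hx hy
    obtain ⟨x, rfl⟩ := Nat.exists_eq_add_of_le (show k ≤ x by omega)
    obtain ⟨y, rfl⟩ := Nat.exists_eq_add_of_le (show k ≤ y by omega)
  · exact h₄ ⟨by omega, by omega⟩ ⟨by omega, by omega⟩ (by omega)
  · exact h₆ ⟨by omega, by omega⟩ ⟨by omega, by omega⟩ (by omega)
  · exact h₈ ⟨by omega, by omega⟩ ⟨by omega, by omega⟩ (by omega)

/-- A sequence that weakly climbs to a peak and weakly descends from it, and that is lower at both
ends than at the peak, is one-turn. -/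
theorem oneTurn_of_peak {f : ℕ → ℕ} {a p b : ℕ} (hap : a ≤ p) (hpb : p ≤ b)
    (hup : MonotoneOn f (Set.Icc a p)) (hdown : AntitoneOn f (Set.Icc p b))
    (ha : f a < f p) (hb : f b < f p) : OneTurn f a b := by
  -- `i` is the last position before the peak that is lower than the peak, and `j` is the last
  -- position after it that is as high as the peak.
  obtain ⟨i, hi₁, hi₂, hi₃, himax⟩ := exists_last_index (P := fun k => f k < f p) hap ha
  obtain ⟨j, hj₁, hj₂, hj₃, hjmax⟩ := exists_last_index (P := fun k => f p ≤ f k) hpb le_rfl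
  simp only [not_lt, not_le] at himax hjmax
  have hip : i < p := lt_of_le_of_ne hi₂ (by rintro rfl; exact lt_irrefl _ hi₃)
  have hjb : j < b := lt_of_le_of_ne hj₂ (by rintro rfl; omega)
  have hfj : ∀ k, p ≤ k → k ≤ b → f k ≤ f p := fun k h₁ h₂ => hdown ⟨le_rfl, hpb⟩ ⟨h₁, h₂⟩ h₁
  have hconst : ∀ k, i < k → k ≤ j → f k = f p := by
    intro k h₁ h₂
    rcases le_total k p with h | h
    · exact le_antisymm (hup ⟨by omega, h⟩ ⟨hap, le_rfl⟩ h) (himax k h₁ h)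
    · exact le_antisymm (hfj k h (by omega))
        (hj₃.trans (hdown ⟨h, by omega⟩ ⟨hj₁, hj₂⟩ h₂))
  refine ⟨i, j, hi₁, by omega, hjb, hup.mono (Set.Icc_subset_Icc le_rfl hi₂), ?_, ?_, ?_,
    hdown.mono (Set.Icc_subset_Icc (by omega) le_rfl)⟩
  · rw [hconst (i + 1) (by omega) (by omega)]; exact hi₃
  · intro x hx y hy _
    rw [hconst x (by have := hx.1; omega) hx.2, hconst y (by have := hy.1; omega) hy.2]
  · rw [hconst j (by omega) le_rfl]; exact hjmax _ (by omega) (by omega)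

end PDA

/-- `HasTurns R ht l a b`: a sequence of `R`-steps from `a` to `b` is divided into `l` one-turn
sequences. -/
def HasTurns (R : X → X → Prop) (ht : X → ℕ) (l : ℕ) (a b : X) : Prop :=
  ∃ (n : ℕ) (f : ℕ → X) (s : ℕ → ℕ), f 0 = a ∧ f n = b ∧ (∀ t < n, R (f t) (f (t + 1))) ∧
    s 0 = 0 ∧ s l = n ∧ ∀ j < l, PDA.OneTurn (fun t => ht (f t)) (s j) (s (j + 1))

theorem HasTurns.zero (a : X) : HasTurns R ht 0 a a :=
  ⟨0, fun _ => a, fun _ => 0, rfl, rfl, by simp, rfl, rfl, by simp⟩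

theorem exists_seq_oneTurn {a p b : X} (hup : Climbs R ht a p) (hdown : Descends R ht p b)
    (ha : ht a < ht p) (hb : ht b < ht p) : ∃ (n : ℕ) (f : ℕ → X), f 0 = a ∧ f n = b ∧
      (∀ t < n, R (f t) (f (t + 1))) ∧ PDA.OneTurn (fun t => ht (f t)) 0 n := by
  obtain ⟨n, f, hf₀, hfn, hf⟩ := exists_seq_of_reflTransGen hup
  obtain ⟨k, g, hg₀, hgk, hg⟩ := exists_seq_of_reflTransGen hdown
  have hF : ∀ t, n ≤ t → (fun t => if t ≤ n then f t else g (t - n)) t = g (t - n) := by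
    intro t ht
    rcases ht.eq_or_lt with rfl | h
    · simp [hfn, hg₀]
    · simp [Nat.not_le.mpr h]
  have hF' : ∀ t, t ≤ n → (fun t => if t ≤ n then f t else g (t - n)) t = f t := by
    intro t ht
    simp [ht]
  generalize (fun t => if t ≤ n then f t else g (t - n)) = F at hF hF'
  have hlow : ∀ t < n, R (F t) (F (t + 1)) ∧ ht (F t) ≤ ht (F (t + 1)) := by
    intro t ht
    rw [hF' t ht.le, hF' _ ht]; exact hf t ht
  have hhigh : ∀ t, n ≤ t → t < n + k → R (F t) (F (t + 1)) ∧ ht (F (t + 1)) ≤ ht (F t) := by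
    intro t h₁ h₂
    rw [hF t h₁, hF _ (by omega), show t + 1 - n = t - n + 1 by omega]
    exact hg _ (by omega)
  have e₀ : F 0 = a := by rw [hF' 0 (by omega), hf₀]
  have e₁ : F n = p := by rw [hF' n le_rfl, hfn]
  have e₂ : F (n + k) = b := by rw [hF _ (by omega), Nat.add_sub_cancel_left, hgk]
  refine ⟨n + k, F, e₀, e₂, fun t h => ?_, ?_⟩
  · rcases Nat.lt_or_ge t n with h' | h'
    · exact (hlow t h').1
    · exact (hhigh t h' h).1
  · refine PDA.oneTurn_of_peak (p := n) (by omega) (by omega) ?_ ?_ ?_ ?_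
    · intro x hx y hy hxy
      have hyn := hy.2
      induction y, hxy using Nat.le_induction with
      | base => exact le_rfl
      | succ y hxy ih =>
        exact (ih ⟨by omega, by omega⟩ (by omega)).trans (hlow y (by omega)).2
    · intro x hx y hy hxy
      have hxn := hx.1
      have hyn := hy.2
      induction y, hxy using Nat.le_induction with
      | base => exact le_rfl
      | succ y hxy ih =>
        exact (hhigh y (by omega) (by omega)).2.trans (ih ⟨by omega, by omega⟩ (by omega))
    · simpa only [e₀, e₁] using ha
    · simpa only [e₂, e₁] using hb

theorem HasTurns.succ {l : ℕ} {a b p c : X} (h : HasTurns R ht l a b) (hup : Climbs R ht b p)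
    (hdown : Descends R ht p c) (hb : ht b < ht p) (hc : ht c < ht p) :
    HasTurns R ht (l + 1) a c := by
  obtain ⟨n, f, s, hf₀, hfn, hf, hs₀, hsl, hs⟩ := h
  obtain ⟨k, g, hg₀, hgk, hg, hgt⟩ := exists_seq_oneTurn hup hdown hb hc
  have hF : ∀ t, (fun t => if t ≤ n then f t else g (t - n)) (n + t) = g t := by
    intro t
    rcases Nat.eq_zero_or_pos t with rfl | h
    · simp [hfn, hg₀]
    · simp [Nat.ne_of_gt h]
  have hF' : ∀ t, t ≤ n → (fun t => if t ≤ n then f t else g (t - n)) t = f t := by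
    intro t ht
    simp [ht]
  generalize (fun t => if t ≤ n then f t else g (t - n)) = F at hF hF'
  have hsle : ∀ j i, j + i ≤ l → s j ≤ s (j + i) := by
    intro j i
    induction i with
    | zero => simp
    | succ i ih => exact fun h => (ih (by omega)).trans (hs (j + i) (by omega)).lt.le
  refine ⟨n + k, F, fun j => if j ≤ l then s j else n + k, ?_, ?_, ?_, ?_, ?_, ?_⟩
  · rw [hF' 0 (by omega), hf₀]
  · rw [hF, hgk]
  · intro t h
    rcases Nat.lt_or_ge t n with h' | h'
    · rw [hF' t h'.le, hF' _ h']; exact hf t h'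
    · obtain ⟨t, rfl⟩ := Nat.exists_eq_add_of_le h'
      rw [hF, Nat.add_assoc, hF]
      exact hg t (by omega)
  · simpa using hs₀
  · simp
  · intro j hj
    rcases Nat.lt_or_ge j l with h' | h'
    · simp only [h'.le, Nat.succ_le_of_lt h', if_true]
      refine (hs j h').congr fun t ht => ?_
      have := hsle (j + 1) (l - (j + 1)) (by omega)
      rw [Nat.add_sub_cancel' h', hsl] at this
      simp only [hF' t (by have := ht.2; omega)]
    · obtain rfl : j = l := by omega
      simp only [le_refl, if_true, hsl, Nat.not_succ_le_self, if_false]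
      refine PDA.oneTurn_shift (a := 0) (hgt.congr fun t _ => ?_)
      simp only [hF]

end Turns

/-! ### Loop systems and their automata -/

/-- The stack alphabet of the constructed automata: the bottom symbol, a counter symbol, and a
separator between counters. -/
inductive StackSymbol
  | bot
  | one
  | sep
  deriving DecidableEq

instance : Fintype StackSymbol := ⟨{.bot, .one, .sep}, by rintro (_ | _ | _) <;> simp⟩

/-- Finitely many semilinear sets, indexed by `I`, over the letters `0, …, m - 1`. The set with
index `x` has the constant vector `base x`; `loop x t v i j` says that `i e_t + j e_v` is one of its
periods, where `e_m = 0`. Periods do not cross, and `B` bounds all coefficients. -/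
structure LoopSystem (m B : ℕ) (I : Type) where
  base : I → ℕ → ℕ
  loop : I → ℕ → ℕ → ℕ → ℕ → Prop
  base_le : ∀ x t, base x t ≤ B
  loop_le : ∀ {x t v i j}, loop x t v i j → t < v ∧ v ≤ m ∧ i ≤ B ∧ j ≤ B
  loop_top : ∀ {x t i j}, loop x t m i j → j = 0
  noncrossing : ∀ {x l s i j t r i' j'}, loop x l s i j → loop x t r i' j' →
    l < t → t < s → s < r → False

/-- The `v`-th unit vector, which is zero for `v ≥ m`. -/
def unitVec (m v : ℕ) : Fin m → ℕ := fun a => if a.val = v then 1 else 0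

namespace LoopSystem

variable {m B : ℕ} {I : Type}

/-- The periods of the semilinear set with index `x`. -/
def periods (L : LoopSystem m B I) (x : I) : Set (Fin m → ℕ) :=
  {p | ∃ t v i j, L.loop x t v i j ∧ p = i • unitVec m t + j • unitVec m v}

/-- The sorted words whose Parikh vectors belong to one of the semilinear sets. -/
def language (L : LoopSystem m B I) : Language (Fin m) :=
  {w | w.Pairwise (· ≤ ·) ∧ ∃ x, ∃ n ∈ AddSubmonoid.closure (L.periods x),
    parikh w = (fun a : Fin m => L.base x a) + n}

/-- The states of the automaton. In the state `run x t v i j` the current letter is `t`, and `i`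
occurrences of it have to be read and `j` counter symbols have to be pushed before anything else
is done; the counter symbols on top of the stack will be matched with occurrences of the letter
`v`. The state `peak x t v` is visited between the letters `t` and `t + 1`. -/
inductive State (I : Type)
  | start
  | acc
  | run (x : I) (t v i j : ℕ)
  | peak (x : I) (t v : ℕ)

/-- The moves of the automaton. The `n` separators on the stack encode the level `v = m - n`, so
that a counter symbol is popped at the same level at which it was pushed. -/
inductive Move (L : LoopSystem m B I) :
    State I → Option (Fin m) → StackSymbol → State I → List StackSymbol → Prop
  | init (x : I) : Move L .start none .bot (.run x 0 m (L.base x 0) 0) [.bot]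
  | read {x : I} {a : Fin m} {v i j : ℕ} {Z : StackSymbol} :
      Move L (.run x a v (i + 1) j) (some a) Z (.run x a v i j) [Z]
  | push {x : I} {t v j : ℕ} {Z : StackSymbol} :
      Move L (.run x t v 0 (j + 1)) none Z (.run x t v 0 j) [.one, Z]
  | loop {x : I} {t v i j : ℕ} {Z : StackSymbol} (h : L.loop x t v i j) :
      Move L (.run x t v 0 0) none Z (.run x t v i j) [Z]
  | popOne {x : I} {t : ℕ} : Move L (.run x t t 0 0) none .one (.run x t t 1 0) []
  | pushSep {x : I} {t v : ℕ} {Z : StackSymbol} :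
      Move L (.run x t (v + 1) 0 0) none Z (.run x t v 0 0) [.sep, Z]
  | popSep {x : I} {t v : ℕ} (h : v < m) :
      Move L (.run x t v 0 0) none .sep (.run x t (v + 1) 0 0) []
  | up {x : I} {t v : ℕ} {Z : StackSymbol} :
      Move L (.run x t v 0 0) none Z (.peak x t v) [.sep, Z]
  | down {x : I} {t v : ℕ} (h : t + 1 < m) :
      Move L (.peak x t v) none .sep (.run x (t + 1) v (L.base x (t + 1)) 0) []
  | accept {x : I} {t v : ℕ} (h : t + 1 = m) : Move L (.run x t v 0 0) none .bot .acc [.bot]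

/-- The bounds on the components of the states that can be reached. -/
def State.Bounded (m B : ℕ) : State I → Prop
  | .start => True
  | .acc => True
  | .run _ t v i j => t < m ∧ v ≤ m ∧ i ≤ B ∧ j ≤ B
  | .peak _ t v => t < m ∧ v ≤ m

theorem Move.bounded {L : LoopSystem m B I} (hm : 0 < m) (hB : 0 < B) {q p : State I}
    {a : Option (Fin m)} {Z : StackSymbol} {β : List StackSymbol} (h : L.Move q a Z p β)
    (hq : q.Bounded m B) : p.Bounded m B := by
  cases h <;> simp only [State.Bounded] at hq ⊢
  case init x => exact ⟨hm, le_rfl, L.base_le _ _, by omega⟩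
  case down x t v h => exact ⟨h, hq.2, L.base_le _ _, by omega⟩
  case loop x t v i j h => exact ⟨hq.1, hq.2.1, (L.loop_le h).2.2⟩
  all_goals omega

theorem Move.stack_op {L : LoopSystem m B I} {q p : State I} {a : Option (Fin m)}
    {Z : StackSymbol} {β : List StackSymbol} (h : L.Move q a Z p β) :
    β = [Z] ∨ (β = [] ∧ Z ≠ .bot) ∨ ∃ Y, Y ≠ StackSymbol.bot ∧ β = [Y, Z] := by
  cases h <;> simp

theorem Move.read_op {L : LoopSystem m B I} {q p : State I} {a : Fin m}
    {Z : StackSymbol} {β : List StackSymbol} (h : L.Move q (some a) Z p β) : β = [Z] := by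
  cases h; rfl

/-- The computation steps of the automaton, on configurations with unbounded states. -/
inductive Step (L : LoopSystem m B I) : PDA.Config (Fin m) (State I) StackSymbol →
    PDA.Config (Fin m) (State I) StackSymbol → Prop
  | read {q p : State I} {a : Fin m} {w : List (Fin m)} {Z : StackSymbol}
      {β γ : List StackSymbol} (h : L.Move q (some a) Z p β) :
      Step L ⟨q, a :: w, Z :: γ⟩ ⟨p, w, β ++ γ⟩
  | eps {q p : State I} {w : List (Fin m)} {Z : StackSymbol}
      {β γ : List StackSymbol} (h : L.Move q none Z p β) :
      Step L ⟨q, w, Z :: γ⟩ ⟨p, w, β ++ γ⟩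

/-! ### Soundness of the automaton -/

/-- The occurrences of letters that are matched with the counter symbols of a stack when the level
is `v`. -/
def pending (m : ℕ) : ℕ → List StackSymbol → Fin m → ℕ
  | _, [] => 0
  | _, .bot :: _ => 0
  | v, .one :: γ => unitVec m v + pending m v γ
  | v, .sep :: γ => pending m (v + 1) γ

/-- The bottom symbol occurs at the bottom of the stack and nowhere else. -/
def WellFormed : List StackSymbol → Prop
  | [] => False
  | .bot :: γ => γ = []
  | .one :: γ => WellFormed γ
  | .sep :: γ => WellFormed γ

/-- The part of `w` that has been read, together with all obligations, accounts for the constants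
of the letters up to `t` and some loops. -/
def Balanced (L : LoopSystem m B I) (w : List (Fin m)) (x : I) (t v i j : ℕ)
    (r : List (Fin m)) (γ : List StackSymbol) : Prop :=
  WellFormed γ ∧ ∃ u, w = u ++ r ∧ u.Pairwise (· ≤ ·) ∧ (∀ a ∈ u, a.val ≤ t) ∧
    ∃ n ∈ AddSubmonoid.closure (L.periods x), ∀ a,
      u.count a + i * unitVec m t a + j * unitVec m v a + pending m v γ a =
        (if a.val ≤ t then L.base x a else 0) + n a

/-- The invariant of the computations on the input `w`. -/
def Invariant (L : LoopSystem m B I) (w : List (Fin m)) :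
    PDA.Config (Fin m) (State I) StackSymbol → Prop
  | ⟨.start, r, γ⟩ => r = w ∧ γ = [.bot]
  | ⟨.acc, r, γ⟩ => γ = [.bot] ∧ ∃ u, w = u ++ r ∧ u ∈ L.language
  | ⟨.run x t v i j, r, γ⟩ => L.Balanced w x t v i j r γ
  | ⟨.peak x t v, r, γ⟩ => ∃ γ', γ = .sep :: γ' ∧ L.Balanced w x t v 0 0 r γ'

theorem Invariant.step {L : LoopSystem m B I} {w : List (Fin m)}
    {C D : PDA.Config (Fin m) (State I) StackSymbol} (hC : L.Invariant w C) (h : L.Step C D) :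
    L.Invariant w D := by
  cases h with
  | @read q p a r Z β γ h =>
    cases h with
    | @read x _ v i j _ =>
      obtain ⟨hγ, u, rfl, hu, hua, n, hn, e⟩ := hC
      refine ⟨hγ, u ++ [a], by simp, ?_, ?_, n, hn, ?_⟩
      · rw [List.pairwise_append]
        refine ⟨hu, List.pairwise_singleton _ _, fun b hb c hc => ?_⟩
        obtain rfl := List.mem_singleton.mp hc
        exact hua b hb
      · intro b hb
        rcases List.mem_append.mp hb with hb | hb
        · exact hua b hb
        · rw [List.mem_singleton.mp hb]
      · intro b
        rw [← e b, List.count_append, List.count_singleton]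
        have : (if (a == b) = true then 1 else 0) = unitVec m a b := by
          simp only [unitVec, beq_iff_eq, Fin.ext_iff, eq_comm (a := a.val)]
        rw [this, List.singleton_append]
        ring
  | @eps q p r Z β γ h =>
    cases h with
    | init x =>
      obtain ⟨rfl, hγ⟩ := hC
      obtain rfl : γ = [] := by simpa using hγ
      refine ⟨rfl, [], by simp, by simp, by simp, 0, zero_mem _, fun a => ?_⟩
      by_cases ha : a.val = 0 <;> simp [unitVec, pending, ha]
    | @push x t v j _ =>
      obtain ⟨hγ, u, rfl, hu, hua, n, hn, e⟩ := hC
      refine ⟨hγ, u, rfl, hu, hua, n, hn, fun a => ?_⟩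
      rw [← e a]
      simp only [List.cons_append, List.nil_append, pending, Pi.add_apply]
      ring
    | @loop x t v i j _ h =>
      obtain ⟨hγ, u, rfl, hu, hua, n, hn, e⟩ := hC
      refine ⟨hγ, u, rfl, hu, hua, n + (i • unitVec m t + j • unitVec m v),
        add_mem hn (AddSubmonoid.subset_closure ⟨t, v, i, j, h, rfl⟩), fun a => ?_⟩
      have := e a
      simp only [List.cons_append, List.nil_append, Pi.add_apply, Pi.smul_apply, smul_eq_mul]
        at this ⊢
      omega
    | @popOne x t =>
      obtain ⟨hγ, u, rfl, hu, hua, n, hn, e⟩ := hC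
      refine ⟨hγ, u, rfl, hu, hua, n, hn, fun a => ?_⟩
      rw [← e a]
      simp only [List.nil_append, pending, Pi.add_apply]
      ring
    | @pushSep x t v _ =>
      obtain ⟨hγ, u, rfl, hu, hua, n, hn, e⟩ := hC
      refine ⟨hγ, u, rfl, hu, hua, n, hn, fun a => ?_⟩
      rw [← e a]
      simp [pending]
    | @popSep x t v h =>
      obtain ⟨hγ, u, rfl, hu, hua, n, hn, e⟩ := hC
      refine ⟨hγ, u, rfl, hu, hua, n, hn, fun a => ?_⟩
      rw [← e a]
      simp [pending]
    | up => exact ⟨_, rfl, hC⟩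
    | @down x t v h =>
      obtain ⟨γ', e, hγ, u, rfl, hu, hua, n, hn, e'⟩ := hC
      obtain rfl := List.cons.inj e |>.2
      refine ⟨hγ, u, rfl, hu, fun a ha => (hua a ha).trans (Nat.le_succ _), n, hn, fun a => ?_⟩
      have := e' a
      rcases lt_trichotomy a.val (t + 1) with ha | ha | ha
      · have h₁ : a.val ≤ t := by omega
        have h₂ : a.val ≠ t + 1 := by omega
        simp only [h₁, ha.le, if_true, unitVec, h₂, if_false, List.nil_append] at this ⊢
        omega
      · have h₁ : ¬ a.val ≤ t := by omega
        have h₂ : a.val ≠ t := by omega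
        have h₃ : L.base x a.val = L.base x (t + 1) := by rw [ha]
        simp only [if_neg h₁, if_neg h₂, if_pos ha, if_pos ha.le, unitVec, List.nil_append]
          at this ⊢
        omega
      · have h₁ : ¬ a.val ≤ t := by omega
        have h₂ : ¬ a.val ≤ t + 1 := by omega
        have h₃ : a.val ≠ t + 1 := by omega
        simp only [h₁, h₂, h₃, unitVec, if_false, List.nil_append] at this ⊢
        omega
    | @accept x t v h =>
      obtain ⟨hγ, u, rfl, hu, hua, n, hn, e⟩ := hC
      obtain rfl : γ = [] := hγ
      refine ⟨rfl, u, rfl, hu, x, n, hn, ?_⟩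
      funext a
      have := e a
      have ha : a.val ≤ t := by omega
      simpa [parikh, pending, ha] using this

/-! ### Completeness of the automaton -/

variable {L : LoopSystem m B I}

/-- The stack below the counter symbols of level `v`, where `q s` counter symbols are stored at each
level `s > v`. -/
def tower (m : ℕ) (q : ℕ → ℕ) (v : ℕ) : List StackSymbol :=
  if v < m then .sep :: (List.replicate (q (v + 1)) .one ++ tower m q (v + 1)) else [.bot]
termination_by m - v

theorem tower_of_lt {q : ℕ → ℕ} {v : ℕ} (h : v < m) :
    tower m q v = .sep :: (List.replicate (q (v + 1)) .one ++ tower m q (v + 1)) := by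
  rw [tower, if_pos h]

theorem tower_top {q : ℕ → ℕ} : tower m q m = [.bot] := by
  rw [tower, if_neg (lt_irrefl _)]

theorem tower_congr {q q' : ℕ → ℕ} {v : ℕ} (hv : v ≤ m)
    (h : ∀ s, v < s → s ≤ m → q s = q' s) : tower m q v = tower m q' v := by
  induction hv using Nat.decreasingInduction with
  | self => rw [tower_top, tower_top]
  | of_succ k hk ih =>
    rw [tower_of_lt hk, tower_of_lt hk, h _ (Nat.lt_succ_self _) hk,
      ih fun s hs hsm => h s (by omega) hsm]

theorem exists_tower_eq_cons (q : ℕ → ℕ) {v : ℕ} (hv : v ≤ m) (k : ℕ) :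
    ∃ Z γ, List.replicate k .one ++ tower m q v = Z :: γ := by
  rw [← List.ne_nil_iff_exists_cons]
  rcases hv.eq_or_lt with rfl | h
  · simp [tower_top]
  · simp [tower_of_lt h]

/-- The height of the stack of a configuration. -/
def height (C : PDA.Config (Fin m) (State I) StackSymbol) : ℕ := C.stack.length

theorem levels_read (x : I) (a : Fin m) (v i j k : ℕ) (r : List (Fin m)) (Z : StackSymbol)
    (γ : List StackSymbol) :
    Levels L.Step height ⟨.run x a v (i + k) j, List.replicate k a ++ r, Z :: γ⟩
      ⟨.run x a v i j, r, Z :: γ⟩ := by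
  induction k with
  | zero => exact .refl
  | succ k ih =>
    refine Relation.ReflTransGen.head ⟨?_, ?_⟩ ih
    · exact Step.read (β := [Z]) Move.read
    · rfl

theorem climbs_push (x : I) (t v k : ℕ) (r : List (Fin m)) (Z : StackSymbol)
    (γ : List StackSymbol) :
    Climbs L.Step height ⟨.run x t v 0 k, r, Z :: γ⟩
      ⟨.run x t v 0 0, r, List.replicate k .one ++ Z :: γ⟩ := by
  induction k generalizing Z γ with
  | zero => exact .refl
  | succ k ih =>
    rw [List.replicate_succ', List.append_assoc]
    refine Relation.ReflTransGen.head ⟨Step.eps (β := [.one, Z]) Move.push, ?_⟩ (ih _ _)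
    simp [height]

theorem climbs_loops {x : I} {a : Fin m} {v : ℕ} {d : ℕ × ℕ}
    (hd : d ∈ AddSubmonoid.closure {d : ℕ × ℕ | L.loop x a v d.1 d.2}) (r : List (Fin m))
    (Z : StackSymbol) (γ : List StackSymbol) :
    Climbs L.Step height ⟨.run x a v 0 0, List.replicate d.1 a ++ r, Z :: γ⟩
      ⟨.run x a v 0 0, r, List.replicate d.2 .one ++ Z :: γ⟩ := by
  induction hd using AddSubmonoid.closure_induction generalizing r Z γ with
  | mem d hd =>
    have h₁ := (levels_read (L := L) x a v 0 d.2 d.1 r Z γ).climbs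
    rw [Nat.zero_add] at h₁
    exact Relation.ReflTransGen.head ⟨Step.eps (β := [Z]) (Move.loop hd), le_rfl⟩
      (h₁.trans (climbs_push x a v d.2 r Z γ))
  | zero => exact .refl
  | add d d' _ _ ih ih' =>
    have h₁ := ih (List.replicate d'.1 a ++ r) Z γ
    obtain ⟨Y, η, e⟩ : ∃ Y η, List.replicate d.2 .one ++ Z :: γ = Y :: η := by
      rw [← List.ne_nil_iff_exists_cons]; simp
    have h₂ := ih' r Y η
    rw [← e] at h₂
    rw [← List.append_assoc, ← List.replicate_add] at h₁ h₂
    rw [Nat.add_comm d'.2 d.2] at h₂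
    exact h₁.trans h₂

theorem descends_popOne (x : I) (a : Fin m) (k : ℕ) (r : List (Fin m)) (Z : StackSymbol)
    (γ : List StackSymbol) :
    Descends L.Step height
      ⟨.run x a a 0 0, List.replicate k a ++ r, List.replicate k .one ++ Z :: γ⟩
      ⟨.run x a a 0 0, r, Z :: γ⟩ := by
  induction k with
  | zero => exact .refl
  | succ k ih =>
    obtain ⟨Y, η, e⟩ : ∃ Y η, List.replicate k .one ++ Z :: γ = Y :: η := by
      rw [← List.ne_nil_iff_exists_cons]; simp
    rw [e] at ih
    rw [List.replicate_succ, List.replicate_succ, List.cons_append, List.cons_append, e]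
    refine Relation.ReflTransGen.head ⟨Step.eps (β := []) Move.popOne, by simp [height]⟩
      (Relation.ReflTransGen.head ⟨Step.read (β := [Y]) (Move.read (i := 0)), le_rfl⟩ ih)

theorem descends_popSep (x : I) {q : ℕ → ℕ} {t v : ℕ} (hv : t + 1 ≤ v) (hvm : v ≤ m)
    (hq : ∀ s, t < s → s < v → q s = 0) (r : List (Fin m)) :
    Descends L.Step height ⟨.run x t t 0 0, r, tower m q t⟩
      ⟨.run x t v 0 0, r, List.replicate (q v) .one ++ tower m q v⟩ := by
  induction v, hv using Nat.le_induction with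
  | base =>
    rw [tower_of_lt hvm]
    exact Relation.ReflTransGen.single
      ⟨Step.eps (β := []) (Move.popSep hvm), by simp [height]⟩
  | succ v hv ih =>
    have h := ih (by omega) fun s h₁ h₂ => hq s h₁ (by omega)
    rw [hq v hv (Nat.lt_succ_self v), List.replicate_zero, List.nil_append,
      tower_of_lt (v := v) hvm] at h
    exact Relation.ReflTransGen.tail h
      ⟨Step.eps (β := []) (Move.popSep hvm), by simp [height]⟩

/-- From the level `v`, the automaton passes through the loops that start with the letter `a` in
the order of decreasing second letters. -/
theorem climbs_pushLevels {x : I} {a : Fin m} {d : ℕ → ℕ × ℕ}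
    (hd : ∀ s, d s ∈ AddSubmonoid.closure {d : ℕ × ℕ | L.loop x a s d.1 d.2})
    {q : ℕ → ℕ} {v k : ℕ} (hv : a.val + 1 ≤ v) (hvm : v ≤ m) (hk : k + (d v).2 = q v)
    (hq : ∀ s, a.val < s → s < v → q s = (d s).2) (r : List (Fin m)) :
    Climbs L.Step height
      ⟨.run x a v 0 0, List.replicate (∑ s ∈ Finset.Ioc a.val v, (d s).1) a ++ r,
        List.replicate k .one ++ tower m q v⟩
      ⟨.run x a (a.val + 1) 0 0, r,
        List.replicate (q (a.val + 1)) .one ++ tower m q (a.val + 1)⟩ := by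
  have key : ∀ (v k : ℕ) (r : List (Fin m)), v ≤ m → k + (d v).2 = q v →
      Climbs L.Step height
        ⟨.run x a v 0 0, List.replicate (d v).1 a ++ r, List.replicate k .one ++ tower m q v⟩
        ⟨.run x a v 0 0, r, List.replicate (q v) .one ++ tower m q v⟩ := by
    intro v k r hvm hk
    obtain ⟨Z, γ, e⟩ := exists_tower_eq_cons q hvm k
    have h := climbs_loops (hd v) r Z γ
    rwa [← e, ← List.append_assoc, ← List.replicate_add, Nat.add_comm, hk] at h
  induction v, hv using Nat.le_induction generalizing k with
  | base =>
    rw [Finset.sum_Ioc_succ_top le_rfl, Finset.Ioc_self, Finset.sum_empty, Nat.zero_add]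
    exact key _ k r hvm hk
  | succ v hv ih =>
    have h := ih (k := 0) (by omega) (by rw [Nat.zero_add, hq v hv (Nat.lt_succ_self v)])
      fun s h₁ h₂ => hq s h₁ (by omega)
    have h' := key (v + 1) k (List.replicate (∑ s ∈ Finset.Ioc a.val v, (d s).1) a ++ r) hvm hk
    rw [← List.append_assoc, ← List.replicate_add, Nat.add_comm (d (v + 1)).1,
      ← Finset.sum_Ioc_succ_top (by omega)] at h'
    refine h'.trans (Relation.ReflTransGen.head ⟨?_, ?_⟩ h)
    · obtain ⟨Z, γ, e⟩ := exists_tower_eq_cons q hvm (q (v + 1))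
      rw [List.replicate_zero, List.nil_append, tower_of_lt hvm, e]
      exact Step.eps (β := [.sep, Z]) Move.pushSep
    · simp [height, tower_of_lt (q := q) (v := v) hvm]

end LoopSystem

namespace LoopSystem

variable {m B : ℕ} {I : Type} {L : LoopSystem m B I}

theorem exists_loop_of_ne_zero {x : I} {t v : ℕ} {d : ℕ × ℕ}
    (hd : d ∈ AddSubmonoid.closure {d : ℕ × ℕ | L.loop x t v d.1 d.2}) (h : d ≠ 0) :
    ∃ i j, L.loop x t v i j := by
  by_contra! hno
  have he : {d : ℕ × ℕ | L.loop x t v d.1 d.2} = ∅ :=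
    Set.eq_empty_of_forall_notMem fun d hd => hno _ _ hd
  rw [he, AddSubmonoid.closure_empty, AddSubmonoid.mem_bot] at hd
  exact h hd

theorem snd_eq_zero_of_top {x : I} {t : ℕ} {d : ℕ × ℕ}
    (hd : d ∈ AddSubmonoid.closure {d : ℕ × ℕ | L.loop x t m d.1 d.2}) : d.2 = 0 := by
  induction hd using AddSubmonoid.closure_induction with
  | mem d hd => exact L.loop_top hd
  | zero => rfl
  | add d d' _ _ h h' => simp [h, h']

/-- A sum of periods is sorted by the pairs of letters to which the periods belong: `(d t v).1`
occurrences of `t` and `(d t v).2` occurrences of `v` come from loops for the pair `(t, v)`. -/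
theorem exists_pair_sums {x : I} {n : Fin m → ℕ} (hn : n ∈ AddSubmonoid.closure (L.periods x)) :
    ∃ d : ℕ → ℕ → ℕ × ℕ,
      (∀ t v, d t v ∈ AddSubmonoid.closure {d : ℕ × ℕ | L.loop x t v d.1 d.2}) ∧
      ∀ a, n a = ∑ v ∈ Finset.range (m + 1), (d a v).1 + ∑ t ∈ Finset.range m, (d t a).2 := by
  induction hn using AddSubmonoid.closure_induction with
  | mem p hp =>
    obtain ⟨t, v, i, j, h, rfl⟩ := hp
    refine ⟨fun t' v' => if t' = t ∧ v' = v then (i, j) else 0, fun t' v' => ?_, fun a => ?_⟩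
    · dsimp only
      split_ifs with h'
      · obtain ⟨rfl, rfl⟩ := h'
        exact AddSubmonoid.subset_closure h
      · exact zero_mem _
    · have hle := L.loop_le h
      have h₁ : ∀ v', (if a.val = t ∧ v' = v then (i, j) else 0).1 =
          if v' = v then (if a.val = t then i else 0) else 0 := by
        intro v'; split_ifs <;> simp_all
      have h₂ : ∀ t', (if t' = t ∧ a.val = v then (i, j) else 0).2 =
          if t' = t then (if a.val = v then j else 0) else 0 := by
        intro v'; split_ifs <;> simp_all
      simp only [h₁, h₂, Finset.sum_ite_eq', Finset.mem_range]
      rw [if_pos (show v < m + 1 by omega), if_pos (show t < m by omega)]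
      simp [unitVec]
  | zero => exact ⟨fun _ _ => 0, fun _ _ => zero_mem _, by simp⟩
  | add p p' _ _ ih ih' =>
    obtain ⟨d, hd, e⟩ := ih
    obtain ⟨d', hd', e'⟩ := ih'
    refine ⟨fun t v => d t v + d' t v, fun t v => add_mem (hd t v) (hd' t v), fun a => ?_⟩
    simp only [Pi.add_apply, Prod.fst_add, Prod.snd_add, Finset.sum_add_distrib, e, e']
    ring

/-- The part of the sorted word `w` that consists of the letters from `t` on. -/
def suffix (w : List (Fin m)) (t : ℕ) : List (Fin m) :=
  ((List.finRange m).drop t).flatMap fun i => List.replicate (w.count i) i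

theorem suffix_eq (w : List (Fin m)) (a : Fin m) :
    suffix w a = List.replicate (w.count a) a ++ suffix w (a + 1) := by
  rw [suffix, List.drop_eq_getElem_cons (by simp), List.flatMap_cons]
  simp [suffix]

theorem suffix_top (w : List (Fin m)) : suffix w m = [] := by
  simp [suffix, List.drop_of_length_le]

/-- The number of counter symbols of level `s` that are stored before the letter `t`. -/
def stored (d : ℕ → ℕ → ℕ × ℕ) (t s : ℕ) : ℕ := ∑ l ∈ Finset.range t, (d l s).2

theorem stored_succ (d : ℕ → ℕ → ℕ × ℕ) (t s : ℕ) :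
    stored d (t + 1) s = stored d t s + (d t s).2 := by
  rw [stored, Finset.sum_range_succ, stored]

section LetterRuns

variable {w : List (Fin m)} {x : I} {d : ℕ → ℕ → ℕ × ℕ}

theorem pairSum_eq_zero
    (hd : ∀ t v, d t v ∈ AddSubmonoid.closure {d : ℕ × ℕ | L.loop x t v d.1 d.2}) {t s : ℕ}
    (h : ¬ (t < s ∧ s ≤ m)) : d t s = 0 := by
  by_contra hne
  obtain ⟨i, j, h'⟩ := exists_loop_of_ne_zero (hd t s) hne
  have := L.loop_le h'
  omega

theorem sum_range_fst_eq
    (hd : ∀ t v, d t v ∈ AddSubmonoid.closure {d : ℕ × ℕ | L.loop x t v d.1 d.2}) {a r : ℕ}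
    (hr : r ≤ m) (h : ∀ s, r < s → s ≤ m → d a s = 0) :
    ∑ s ∈ Finset.range (m + 1), (d a s).1 = ∑ s ∈ Finset.Ioc a r, (d a s).1 := by
  symm
  refine Finset.sum_subset (fun s hs => ?_) fun s hs hs' => ?_
  · simp only [Finset.mem_Ioc, Finset.mem_range] at hs ⊢; omega
  · simp only [Finset.mem_Ioc, Finset.mem_range] at hs hs'
    by_cases hsr : r < s
    · rw [h s hsr (by omega)]; rfl
    · rw [pairSum_eq_zero (t := a) hd (by omega)]; rfl

theorem sum_range_snd_eq
    (hd : ∀ t v, d t v ∈ AddSubmonoid.closure {d : ℕ × ℕ | L.loop x t v d.1 d.2}) {a : ℕ}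
    (ha : a < m) : ∑ t ∈ Finset.range m, (d t a).2 = stored d a a := by
  symm
  refine Finset.sum_subset (fun s hs => ?_) fun s hs hs' => ?_
  · simp only [Finset.mem_range] at hs ⊢; omega
  · simp only [Finset.mem_range] at hs hs'
    rw [pairSum_eq_zero (t := s) hd (by omega)]; rfl

/-- The configuration that is reached when the letter `t` has been treated. -/
def letterEnd (w : List (Fin m)) (x : I) (d : ℕ → ℕ → ℕ × ℕ) (t : ℕ) :
    PDA.Config (Fin m) (State I) StackSymbol :=
  ⟨.run x t (t + 1) 0 0, suffix w (t + 1),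
    List.replicate (stored d (t + 1) (t + 1)) .one ++ tower m (stored d (t + 1)) (t + 1)⟩

/-- The part of a computation that belongs to a letter `a`: after a descent, in which the counter
symbols for `a` are popped, new counter symbols are pushed. -/
theorem exists_letter_run
    (hd : ∀ t v, d t v ∈ AddSubmonoid.closure {d : ℕ × ℕ | L.loop x t v d.1 d.2})
    (hw : ∀ a : Fin m, w.count a = L.base x a +
      (∑ v ∈ Finset.range (m + 1), (d a v).1 + ∑ t ∈ Finset.range m, (d t a).2)) (a : Fin m) :
    ∃ C, Descends L.Step height ⟨.run x a a (L.base x a) 0, suffix w a,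
        List.replicate (stored d a a) .one ++ tower m (stored d a) a⟩ C ∧
      Climbs L.Step height C (letterEnd w x d a) := by
  -- `r` is the largest letter paired with `a`, or `a + 1`.
  obtain ⟨r, hr₁, hr₂, hr₃, hrmax⟩ := exists_last_index
    (P := fun r => r = a.val + 1 ∨ d a r ≠ 0) (a := a.val + 1) (b := m) a.isLt (Or.inl rfl)
  have hmax : ∀ s, r < s → s ≤ m → d a s = 0 := by
    intro s h₁ h₂
    have := hrmax s h₁ h₂
    simp only [not_or, not_not] at this
    exact this.2
  -- As loops do not cross, there are no pending counter symbols for letters between `a` and `r`.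
  have hbetween : ∀ s, a.val < s → s < r → stored d a s = 0 := by
    intro s h₁ h₂
    refine Finset.sum_eq_zero fun l hl => ?_
    by_contra hne
    obtain ⟨i, j, h⟩ := exists_loop_of_ne_zero (hd l s) (fun h => hne (by rw [h]; rfl))
    obtain ⟨i', j', h'⟩ := exists_loop_of_ne_zero (hd a r) (hr₃.resolve_left (by omega))
    exact L.noncrossing h h' (Finset.mem_range.mp hl) h₁ h₂
  refine ⟨⟨.run x a r 0 0, List.replicate (∑ s ∈ Finset.Ioc a.val r, (d a s).1) a ++
    suffix w (a + 1), List.replicate (stored d a r) .one ++ tower m (stored d a) r⟩, ?_, ?_⟩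
  · rw [suffix_eq, hw a, sum_range_snd_eq hd a.isLt, sum_range_fst_eq hd hr₂ hmax,
      Nat.add_comm (∑ s ∈ _, _), List.replicate_add, List.replicate_add, List.append_assoc,
      List.append_assoc]
    obtain ⟨Z, η, e⟩ := exists_tower_eq_cons (stored d a) a.isLt.le (stored d a a)
    obtain ⟨Z', η', e'⟩ := exists_tower_eq_cons (stored d a) a.isLt.le 0
    rw [List.replicate_zero, List.nil_append] at e'
    have h₁ := (levels_read (L := L) x a a 0 0 (L.base x a) (List.replicate (stored d a a) a ++
      (List.replicate (∑ s ∈ Finset.Ioc a.val r, (d a s).1) a ++ suffix w (a + 1))) Z η).descends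
    rw [← e, Nat.zero_add] at h₁
    have h₂ := descends_popOne (L := L) x a (stored d a a)
      (List.replicate (∑ s ∈ Finset.Ioc a.val r, (d a s).1) a ++ suffix w (a + 1)) Z' η'
    rw [← e'] at h₂
    exact h₁.trans (h₂.trans (descends_popSep x hr₁ hr₂ hbetween _))
  · rw [tower_congr (q := stored d a) (q' := stored d (a + 1)) hr₂
      fun s h₁ h₂ => by rw [stored_succ, hmax s h₁ h₂]; rfl]
    exact climbs_pushLevels (hd a) hr₁ hr₂ (stored_succ d a r).symm
      (fun s h₁ h₂ => by rw [stored_succ, hbetween s h₁ h₂, Nat.zero_add]) _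

theorem climbs_first_letter (hs : w.Pairwise (· ≤ ·)) (hm : 0 < m)
    (hd : ∀ t v, d t v ∈ AddSubmonoid.closure {d : ℕ × ℕ | L.loop x t v d.1 d.2})
    (hw : ∀ a : Fin m, w.count a = L.base x a +
      (∑ v ∈ Finset.range (m + 1), (d a v).1 + ∑ t ∈ Finset.range m, (d t a).2)) :
    Climbs L.Step height ⟨.start, w, [.bot]⟩ (letterEnd w x d 0) := by
  have hw0 : w = suffix w 0 := by
    rw [suffix, List.drop_zero]; exact eq_flatMap_replicate_count hs
  have h0 : ∀ s, stored d 0 s = 0 := by simp [stored]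
  have hs0 := suffix_eq w (⟨0, hm⟩ : Fin m)
  rw [hw ⟨0, hm⟩, sum_range_snd_eq hd hm, h0, Nat.add_zero,
    sum_range_fst_eq hd le_rfl (fun s h₁ h₂ => by omega), List.replicate_add,
    List.append_assoc] at hs0
  have h₁ := (levels_read (L := L) x ⟨0, hm⟩ m 0 0 (L.base x 0)
    (List.replicate (∑ s ∈ Finset.Ioc 0 m, (d 0 s).1) ⟨0, hm⟩ ++ suffix w (0 + 1)) .bot []).climbs
  rw [Nat.zero_add] at h₁
  have h₂ := climbs_pushLevels (a := ⟨0, hm⟩) (q := stored d (0 + 1)) (k := 0) (hd 0) hm le_rfl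
    (by rw [stored_succ, h0]) (fun s _ _ => by rw [stored_succ, h0, Nat.zero_add])
    (suffix w (0 + 1))
  rw [tower_top] at h₂
  refine Relation.ReflTransGen.head ⟨Step.eps (β := [.bot]) (Move.init x), le_rfl⟩ ?_
  have h₃ := h₁.trans h₂
  rw [← hs0, ← hw0] at h₃
  exact h₃

theorem exists_peak (w : List (Fin m)) (x : I) (d : ℕ → ℕ → ℕ × ℕ) {t : ℕ} (ht : t + 1 < m) :
    ∃ P, Climbs L.Step height (letterEnd w x d t) P ∧ height (letterEnd w x d t) < height P ∧
      Descends L.Step height P ⟨.run x (t + 1) (t + 1) (L.base x (t + 1)) 0, suffix w (t + 1),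
        List.replicate (stored d (t + 1) (t + 1)) .one ++ tower m (stored d (t + 1)) (t + 1)⟩ := by
  obtain ⟨Z, γ, e⟩ := exists_tower_eq_cons (m := m) (stored d (t + 1)) ht.le
    (stored d (t + 1) (t + 1))
  refine ⟨⟨.peak x t (t + 1), suffix w (t + 1), .sep :: Z :: γ⟩, ?_, ?_, ?_⟩
  · rw [letterEnd, e]
    exact Relation.ReflTransGen.single ⟨Step.eps (β := [.sep, Z]) Move.up, by simp [height]⟩
  · rw [letterEnd, e]
    simp [height]
  · rw [e]
    exact Relation.ReflTransGen.single ⟨Step.eps (β := []) (Move.down ht), by simp [height]⟩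

/-- The treatment of the letters up to `t` turns once between any two adjacent letters. -/
theorem exists_turns_letterEnd (hs : w.Pairwise (· ≤ ·))
    (hd : ∀ t v, d t v ∈ AddSubmonoid.closure {d : ℕ × ℕ | L.loop x t v d.1 d.2})
    (hw : ∀ a : Fin m, w.count a = L.base x a +
      (∑ v ∈ Finset.range (m + 1), (d a v).1 + ∑ t ∈ Finset.range m, (d t a).2))
    {t : ℕ} (ht : t < m) :
    ∃ C, HasTurns L.Step height t ⟨.start, w, [.bot]⟩ C ∧
      Climbs L.Step height C (letterEnd w x d t) := by
  induction t with
  | zero => exact ⟨_, .zero _, climbs_first_letter hs ht hd hw⟩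
  | succ t ih =>
    obtain ⟨C, hC, hup⟩ := ih (by omega)
    obtain ⟨P, hP, hlt, hdown⟩ := exists_peak (L := L) w x d ht
    obtain ⟨D, hD, hend⟩ := exists_letter_run hd hw ⟨t + 1, ht⟩
    have hPD := hdown.trans hD
    refine ⟨D, hC.succ (hup.trans hP) hPD (hup.le.trans_lt hlt) ?_, hend⟩
    refine hD.le.trans_lt ?_
    simpa [height, letterEnd] using hlt

theorem levels_accept
    (hd : ∀ t v, d t v ∈ AddSubmonoid.closure {d : ℕ × ℕ | L.loop x t v d.1 d.2}) {t : ℕ}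
    (ht : t + 1 = m) {C : PDA.Config (Fin m) (State I) StackSymbol}
    (hC : Climbs L.Step height C (letterEnd w x d t)) :
    Levels L.Step height C ⟨.acc, [], [.bot]⟩ := by
  subst ht
  have h0 : stored d (t + 1) (t + 1) = 0 :=
    Finset.sum_eq_zero fun l _ => snd_eq_zero_of_top (hd l _)
  have hend : letterEnd w x d t = ⟨.run x t (t + 1) 0 0, [], [.bot]⟩ := by
    rw [letterEnd, suffix_top, tower_top, h0]; rfl
  rw [hend] at hC
  refine Relation.ReflTransGen.tail (hC.levels ?_) ⟨Step.eps (β := [.bot]) (Move.accept rfl), rfl⟩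
  -- A configuration with an empty stack has no successor.
  rcases Relation.ReflTransGen.cases_head hC with rfl | ⟨D, ⟨h, -⟩, -⟩
  · exact le_rfl
  · cases h <;> simp [height]

end LetterRuns

/-- Every word of the language is accepted by a computation that turns between any two adjacent
letters and nowhere else. -/
theorem exists_turns {w : List (Fin m)} (hm : 0 < m) (hw : w ∈ L.language) :
    HasTurns L.Step height (m - 1) ⟨.start, w, [.bot]⟩ ⟨.acc, [], [.bot]⟩ ∨
      m = 1 ∧ Levels L.Step height ⟨.start, w, [.bot]⟩ ⟨.acc, [], [.bot]⟩ := by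
  obtain ⟨hs, x, n, hn, e⟩ := hw
  obtain ⟨d, hd, hdn⟩ := exists_pair_sums hn
  have hcount : ∀ a : Fin m, w.count a = L.base x a +
      (∑ v ∈ Finset.range (m + 1), (d a v).1 + ∑ t ∈ Finset.range m, (d t a).2) := by
    intro a
    rw [← hdn a]
    exact congrFun e a
  rcases Nat.lt_or_ge 1 m with h1 | h1
  · left
    obtain ⟨t, rfl⟩ := Nat.exists_eq_add_of_le' h1
    obtain ⟨C, hC, hup⟩ := exists_turns_letterEnd hs hd hcount (t := t) (by omega)
    obtain ⟨P, hP, hlt, hdown⟩ := exists_peak (L := L) w x d (t := t) (by omega)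
    obtain ⟨D, hD, hend⟩ := exists_letter_run hd hcount ⟨t + 1, by omega⟩
    have hacc := levels_accept hd rfl hend
    have hPacc := hdown.trans (hD.trans hacc.descends)
    refine hC.succ (hup.trans hP) hPacc (hup.le.trans_lt hlt) ?_
    refine (Descends.le (hD.trans hacc.descends)).trans_lt ?_
    simpa [height, letterEnd] using hlt
  · exact .inr ⟨by omega, levels_accept hd (by omega) (climbs_first_letter hs hm hd hcount)⟩

end LoopSystem

/-! ### The pushdown automaton with finitely many states -/

namespace LoopSystem

variable {m B : ℕ} {I : Type}

/-- The states whose components obey the bounds. -/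
def BoundedState (m B : ℕ) (I : Type) : Type := {s : State I // s.Bounded m B}

/-- Bounded states, as elements of a type whose cardinality is plain. -/
def BoundedState.code (s : BoundedState m B I) :
    Bool ⊕ Bool × I × Fin m × Fin (m + 1) × Fin (B + 1) × Fin (B + 1) :=
  match s with
  | ⟨.start, _⟩ => .inl true
  | ⟨.acc, _⟩ => .inl false
  | ⟨.run x t v i j, h⟩ => .inr (true, x, ⟨t, h.1⟩, ⟨v, Nat.lt_succ_of_le h.2.1⟩,
      ⟨i, Nat.lt_succ_of_le h.2.2.1⟩, ⟨j, Nat.lt_succ_of_le h.2.2.2⟩)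
  | ⟨.peak x t v, h⟩ => .inr (false, x, ⟨t, h.1⟩, ⟨v, Nat.lt_succ_of_le h.2⟩, 0, 0)

theorem BoundedState.code_injective :
    Function.Injective (BoundedState.code : BoundedState m B I → _) := by
  rintro ⟨s, hs⟩ ⟨s', hs'⟩ h
  refine Subtype.ext ?_
  cases s <;> cases s' <;> simp_all [BoundedState.code]

instance [Finite I] : Finite (BoundedState m B I) :=
  Finite.of_injective _ BoundedState.code_injective

theorem card_boundedState_le [Fintype I] [Fintype (BoundedState m B I)] :
    Fintype.card (BoundedState m B I) ≤
      2 + 2 * (Fintype.card I * (m * ((m + 1) * ((B + 1) * (B + 1))))) := by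
  refine (Fintype.card_le_of_injective _ BoundedState.code_injective).trans ?_
  simp

/-- The pushdown automaton of a loop system. -/
def toPDA [Finite I] (L : LoopSystem m B I) : PDA (Fin m) (BoundedState m B I) StackSymbol where
  δ q a Z := {y | L.Move q.1 a Z y.1.1 y.2}
  finite_δ q a Z := by
    refine (Set.finite_univ.prod (List.finite_length_le StackSymbol 2)).subset ?_
    rintro ⟨p, β⟩ h
    refine ⟨trivial, ?_⟩
    rcases Move.stack_op h with rfl | ⟨rfl, -⟩ | ⟨Y, -, rfl⟩ <;> simp
  start := ⟨.start, trivial⟩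
  bottom := .bot
  final := {⟨.acc, trivial⟩}

/-- The configuration with the bound on the state forgotten. -/
def forget (C : PDA.Config (Fin m) (BoundedState m B I) StackSymbol) :
    PDA.Config (Fin m) (State I) StackSymbol :=
  ⟨C.state.1, C.input, C.stack⟩

theorem forget_injective : Function.Injective (forget (m := m) (B := B) (I := I)) := by
  rintro ⟨⟨q, hq⟩, u, γ⟩ ⟨⟨p, hp⟩, v, β⟩ h
  simp only [forget, PDA.Config.mk.injEq] at h
  obtain ⟨rfl, rfl, rfl⟩ := h
  rfl

variable [Finite I] {L : LoopSystem m B I}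

theorem step_forget_iff {C D : PDA.Config (Fin m) (BoundedState m B I) StackSymbol} :
    L.toPDA.Step C D ↔ L.Step (forget C) (forget D) := by
  constructor
  · intro h
    cases h with
    | read h => exact Step.read h
    | eps h => exact Step.eps h
  · obtain ⟨q, u, γ⟩ := C
    obtain ⟨p, v, β⟩ := D
    intro h
    generalize hE : forget (⟨q, u, γ⟩ : PDA.Config (Fin m) (BoundedState m B I) StackSymbol) = E
      at h
    generalize hF : forget (⟨p, v, β⟩ : PDA.Config (Fin m) (BoundedState m B I) StackSymbol) = F
      at h
    cases h with
    | read h =>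
      simp only [forget, PDA.Config.mk.injEq] at hE hF
      obtain ⟨rfl, rfl, rfl⟩ := hE
      obtain ⟨rfl, rfl, rfl⟩ := hF
      exact PDA.Step.read h
    | eps h =>
      simp only [forget, PDA.Config.mk.injEq] at hE hF
      obtain ⟨rfl, rfl, rfl⟩ := hE
      obtain ⟨rfl, rfl, rfl⟩ := hF
      exact PDA.Step.eps h

theorem invariant_of_computation {n : ℕ}
    {c : ℕ → PDA.Config (Fin m) (BoundedState m B I) StackSymbol} {w : List (Fin m)}
    (h : L.toPDA.Computation n c w) {t : ℕ} (ht : t ≤ n) : L.Invariant w (forget (c t)) := by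
  induction t with
  | zero => rw [h.1]; exact ⟨rfl, rfl⟩
  | succ t ih => exact (ih (by omega)).step (step_forget_iff.mp (h.2 t (by omega)))

theorem invariant_of_accepting {n : ℕ}
    {c : ℕ → PDA.Config (Fin m) (BoundedState m B I) StackSymbol} {w : List (Fin m)}
    (h : L.toPDA.Accepting n c w) : (c n).stack = [.bot] ∧ w ∈ L.language := by
  obtain ⟨hc, hf, hi⟩ := h
  have hinv := invariant_of_computation hc le_rfl
  have hs : (c n).state = ⟨.acc, trivial⟩ := hf
  rw [forget, hs, hi] at hinv
  obtain ⟨hγ, u, rfl, hu⟩ := hinv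
  exact ⟨hγ, by simpa using hu⟩

theorem isNormalForm_toPDA : L.toPDA.IsNormalForm where
  stack_op _ _ _ _ h := Move.stack_op h
  read_op _ _ _ _ h := Move.read_op h
  accept_bottom _ _ _ h := (invariant_of_accepting h).1

/-- A sequence of steps between unbounded states that starts in the initial configuration is a
computation of the automaton, since moves preserve the bounds. -/
theorem exists_accepting {n : ℕ} {f : ℕ → PDA.Config (Fin m) (State I) StackSymbol}
    {w : List (Fin m)} (hm : 0 < m) (hB : 0 < B) (h₀ : f 0 = ⟨.start, w, [.bot]⟩)
    (hn : f n = ⟨.acc, [], [.bot]⟩) (hf : ∀ t < n, L.Step (f t) (f (t + 1))) :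
    ∃ c, L.toPDA.Accepting n c w ∧ ∀ t, (c t).stack = (f t).stack := by
  classical
  have hb : ∀ t ≤ n, (f t).state.Bounded m B := by
    intro t
    induction t with
    | zero => intro _; rw [h₀]; trivial
    | succ t ih =>
      intro ht
      have h₁ := ih (by omega)
      have h₂ := hf t ht
      generalize f t = C at h₁ h₂
      generalize f (t + 1) = D at h₂
      cases h₂ with
      | read h => exact h.bounded hm hB h₁
      | eps h => exact h.bounded hm hB h₁
  let c : ℕ → PDA.Config (Fin m) (BoundedState m B I) StackSymbol := fun t =>
    ⟨if h : (f t).state.Bounded m B then ⟨(f t).state, h⟩ else ⟨.start, trivial⟩,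
      (f t).input, (f t).stack⟩
  have hcf : ∀ t ≤ n, forget (c t) = f t := by
    intro t ht
    simp [forget, c, hb t ht]
  have hst : ∀ t ≤ n, (c t).state.1 = (f t).state := fun t ht =>
    congrArg PDA.Config.state (hcf t ht)
  refine ⟨c, ⟨⟨?_, fun t ht => ?_⟩, ?_, ?_⟩, fun t => rfl⟩
  · exact forget_injective ((hcf 0 (Nat.zero_le _)).trans h₀)
  · rw [step_forget_iff, hcf t ht.le, hcf (t + 1) ht]
    exact hf t ht
  · exact Subtype.ext ((hst n le_rfl).trans (by rw [hn]))
  · simp only [c, hn]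

theorem exists_accepting_kTurn {w : List (Fin m)} (hm : 0 < m) (hB : 0 < B)
    (hw : w ∈ L.language) : ∃ n c, L.toPDA.Accepting n c w ∧
      PDA.KTurn (m - 1) (fun t => (c t).stack.length) n := by
  rcases exists_turns hm hw with ⟨n, f, s, h₀, hn, hf, hs⟩ | ⟨rfl, h⟩
  · obtain ⟨c, hc, hcs⟩ := exists_accepting hm hB h₀ hn hf
    refine ⟨n, c, hc, .inr ⟨m - 1, le_rfl, s, ?_⟩⟩
    simp only [hcs]
    exact hs
  · obtain ⟨n, f, h₀, hn, hf⟩ := exists_seq_of_reflTransGen h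
    obtain ⟨c, hc, hcs⟩ := exists_accepting hm hB h₀ hn fun t ht => (hf t ht).1
    refine ⟨n, c, hc, .inl ⟨rfl, fun t ht => ?_⟩⟩
    simp only [hcs]
    induction t with
    | zero => rfl
    | succ t ih => exact (hf t ht).2.symm.trans (ih (by omega))

theorem language_toPDA (hm : 0 < m) (hB : 0 < B) : L.toPDA.language = L.language := by
  ext w
  constructor
  · rintro ⟨n, c, h⟩
    exact (invariant_of_accepting h).2
  · intro h
    obtain ⟨n, c, hc, -⟩ := exists_accepting_kTurn hm hB h
    exact ⟨n, c, hc⟩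

theorem isKTurn_toPDA (hm : 0 < m) (hB : 0 < B) : L.toPDA.IsKTurn (m - 1) := by
  intro w hw
  rw [language_toPDA hm hB] at hw
  exact exists_accepting_kTurn hm hB hw

end LoopSystem

/-! ### The loop system of a grammar -/

namespace ContextFreeGrammar

variable {m : ℕ} {G : ContextFreeGrammar (Fin m)} [DecidableEq G.NT]

theorem parikh_sides_of_isLoop {S : G.NT} {X : Finset G.NT} {w u v : List (Fin m)}
    (hs : ∀ X w, G.Yields S X w → w.Pairwise (· ≤ ·)) (hw : G.Yields S X w)
    (hl : G.IsLoop X u v) (hne : u ≠ [] ∨ v ≠ []) :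
    ∃ t s i j : ℕ, parikh u + parikh v = i • unitVec m t + j • unitVec m s ∧ t < s ∧ s ≤ m ∧
      (s = t + 1 ∧ j = 0 ∨ ∃ a ∈ u, ∃ b ∈ v, a.val = t ∧ b.val = s) := by
  have hrep : ∀ (z : List (Fin m)) (a : Fin m), (∀ b ∈ z, b = a) →
      parikh z = z.length • unitVec m a := by
    intro z a h
    funext b
    by_cases hb : b = a
    · subst hb
      have : parikh z b = z.length := List.count_eq_length.mpr fun c hc => (h c hc).symm
      simp [this, unitVec]
    · have : parikh z b = 0 := List.count_eq_zero_of_not_mem fun hz => hb (h b hz)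
      simp [this, unitVec, Fin.val_inj, hb]
  obtain ⟨h₁, h₂, h₃⟩ := hl.letters hs hw
  rcases u with _ | ⟨a, u⟩
  · rcases v with _ | ⟨b, v⟩
    · simp at hne
    · refine ⟨b, b + 1, (b :: v).length, 0, ?_, by omega, by omega, .inl ⟨rfl, rfl⟩⟩
      rw [hrep (b :: v) b fun c hc => h₂ c hc b (by simp)]
      simp [parikh_nil]
  · rcases v with _ | ⟨b, v⟩
    · refine ⟨a, a + 1, (a :: u).length, 0, ?_, by omega, by omega, .inl ⟨rfl, rfl⟩⟩
      rw [hrep (a :: u) a fun c hc => h₁ c hc a (by simp)]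
      simp [parikh_nil]
    · have hu := hrep (a :: u) a fun c hc => h₁ c hc a (by simp)
      have hv := hrep (b :: v) b fun c hc => h₂ c hc b (by simp)
      have hab : a ≤ b := h₃ a (by simp) b (by simp)
      rcases hab.eq_or_lt with rfl | hab
      · refine ⟨a, a + 1, (a :: u).length + (a :: v).length, 0, ?_, by omega, by omega,
          .inl ⟨rfl, rfl⟩⟩
        rw [hu, hv, add_smul, zero_smul, add_zero]
      · exact ⟨a, b, _, _, by rw [hu, hv], hab, b.isLt.le,
          .inr ⟨a, by simp, b, by simp, rfl, rfl⟩⟩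

/-- The indices of the semilinear sets whose union is the Parikh image of `L(G)`: the variable set
of a parse tree with a short yield, together with the Parikh vector of that yield. -/
def SmallTree (G : ContextFreeGrammar (Fin m)) [DecidableEq G.NT] (B : ℕ) : Type :=
  {y : Finset G.NT × (Fin m → Fin (B + 1)) //
    ∃ w, G.Yields G.initial y.1 w ∧ ∀ a, parikh w a = y.2 a}

instance [Fintype G.NT] (B : ℕ) : Finite (SmallTree G B) :=
  inferInstanceAs (Finite {y : Finset G.NT × (Fin m → Fin (B + 1)) //
    ∃ w, G.Yields G.initial y.1 w ∧ ∀ a, parikh w a = y.2 a})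

theorem card_smallTree_le [Fintype G.NT] (B : ℕ) [Fintype (SmallTree G B)] :
    Fintype.card (SmallTree G B) ≤ 2 ^ Fintype.card G.NT * (B + 1) ^ m := by
  have hinj : Function.Injective (fun y : SmallTree G B => y.1) := Subtype.val_injective
  refine (Fintype.card_le_of_injective _ hinj).trans ?_
  simp

/-- The loop system of a grammar that generates sorted words only. A loop whose sides consist of
two different letters is a period for these letters; every other loop consists of a single letter
`t` and is a period for the pair `(t, t + 1)`, for which nothing is pushed. -/
def loopSystem (G : ContextFreeGrammar (Fin m)) [DecidableEq G.NT]
    (hs : ∀ X w, G.Yields G.initial X w → w.Pairwise (· ≤ ·)) {N B : ℕ} (hNB : N ≤ B) :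
    LoopSystem m B (SmallTree G B) where
  base x t := if h : t < m then x.1.2 ⟨t, h⟩ else 0
  loop x t s i j := ∃ u v, G.IsLoop x.1.1 u v ∧ u.length + v.length ≤ N ∧
    parikh u + parikh v = i • unitVec m t + j • unitVec m s ∧ t < s ∧ s ≤ m ∧
      (s = t + 1 ∧ j = 0 ∨ ∃ a ∈ u, ∃ b ∈ v, a.val = t ∧ b.val = s)
  base_le x t := by
    split_ifs with h
    · exact Nat.le_of_lt_succ (x.1.2 ⟨t, h⟩).isLt
    · exact Nat.zero_le _
  loop_le := by
    rintro x t s i j ⟨u, v, -, hN, e, hts, hsm, h⟩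
    have hle : ∀ a, (parikh u + parikh v) a ≤ B := fun a =>
      (add_le_add (List.count_le_length (a := a)) List.count_le_length).trans (hN.trans hNB)
    refine ⟨hts, hsm, ?_, ?_⟩
    · have := hle ⟨t, by omega⟩
      rw [e] at this
      simpa [unitVec, hts.ne] using this
    · rcases h with ⟨-, rfl⟩ | ⟨a, -, b, -, rfl, rfl⟩
      · exact Nat.zero_le _
      · have := hle b
        rw [e] at this
        simpa [unitVec, hts.ne'] using this
  loop_top := by
    rintro x t i j ⟨u, v, -, -, -, -, -, ⟨-, h⟩ | ⟨a, -, b, -, -, hb⟩⟩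
    · exact h
    · exact absurd hb b.isLt.ne
  noncrossing := by
    rintro x l s i j t r i' j' ⟨u, v, hl, -, -, -, -, h⟩ ⟨u', v', hl', -, -, -, -, h'⟩ h₁ h₂ h₃
    obtain ⟨w, hw, -⟩ := x.2
    rcases h with ⟨h, -⟩ | ⟨a, ha, b, hb, rfl, rfl⟩
    · omega
    rcases h' with ⟨h', -⟩ | ⟨a', ha', b', hb', rfl, rfl⟩
    · omega
    exact hl.noncrossing hs hw hl' ha hb ha' hb' h₁ h₂ h₃

theorem closure_periods_loopSystem
    (hs : ∀ X w, G.Yields G.initial X w → w.Pairwise (· ≤ ·)) {N B : ℕ} (hNB : N ≤ B)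
    (x : SmallTree G B) :
    AddSubmonoid.closure ((loopSystem G hs hNB).periods x) =
      AddSubmonoid.closure (G.loopVectors x.1.1 N) := by
  obtain ⟨w, hw, -⟩ := x.2
  apply le_antisymm <;> rw [AddSubmonoid.closure_le]
  · rintro p ⟨t, s, i, j, ⟨u, v, hl, hN, e, -⟩, rfl⟩
    exact AddSubmonoid.subset_closure ⟨u, v, hl, hN, e.symm⟩
  · rintro p ⟨u, v, hl, hN, rfl⟩
    by_cases hne : u ≠ [] ∨ v ≠ []
    · obtain ⟨t, s, i, j, e, h⟩ := parikh_sides_of_isLoop hs hw hl hne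
      exact AddSubmonoid.subset_closure ⟨t, s, i, j, ⟨u, v, hl, hN, e, h⟩, e⟩
    · simp only [ne_eq, not_or, not_not] at hne
      obtain ⟨rfl, rfl⟩ := hne
      rw [parikh_nil, add_zero]
      exact (AddSubmonoid.closure _).zero_mem

theorem language_loopSystem [Fintype G.NT] (hG : G.IsChomskyNormalForm)
    (hs : ∀ X w, G.Yields G.initial X w → w.Pairwise (· ≤ ·)) {B : ℕ}
    (hNB : 2 ^ (Fintype.card G.NT + 1) ≤ B)
    (hB : Fintype.card G.NT * 2 ^ (Fintype.card G.NT + 1) ≤ B) :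
    (loopSystem G hs hNB).language = G.language := by
  have hbase : ∀ x : SmallTree G B,
      (fun a : Fin m => (loopSystem G hs hNB).base x a) = fun a => (x.1.2 a : ℕ) := by
    intro x
    funext a
    simp [loopSystem]
  ext w
  rw [mem_language_iff_exists_yields hG]
  constructor
  · rintro ⟨hsw, x, n, hn, e⟩
    obtain ⟨v, hv, hvx⟩ := x.2
    rw [closure_periods_loopSystem] at hn
    obtain ⟨w', hw', e'⟩ := hv.exists_parikh_add hn
    refine ⟨x.1.1, ?_⟩
    -- Sorted words with the same Parikh vector are equal.
    have heq : w = w' := by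
      refine List.Perm.eq_of_pairwise (fun a b _ _ => le_antisymm) hsw (hs _ _ hw') ?_
      rw [List.perm_iff_count]
      intro a
      have h₁ := congrFun e a
      rw [hbase, Pi.add_apply, ← hvx, ← Pi.add_apply, ← e'] at h₁
      exact h₁
    rw [heq]
    exact hw'
  · rintro ⟨X, hw⟩
    obtain ⟨w₀, hw₀, hlen, n, hn, e⟩ := hw.exists_small
    have hle : ∀ a, parikh w₀ a < B + 1 := fun a => Nat.lt_succ_of_le <|
      (List.count_le_length (a := a)).trans <| hlen.trans <|
        (Nat.mul_le_mul_right _ (Finset.card_le_univ X)).trans hB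
    let x : SmallTree G B := ⟨(X, fun a => ⟨parikh w₀ a, hle a⟩), w₀, hw₀, fun a => rfl⟩
    refine ⟨hs _ _ hw, x, n, ?_, ?_⟩
    · rw [closure_periods_loopSystem]
      exact hn
    · rw [hbase]
      exact e

end ContextFreeGrammar

/-! ### Conversion of grammars to finite-turn automata -/

theorem mainTheorem1 :
    ∃ K : ℕ, ∀ m : ℕ, 1 ≤ m → ∃ C : ℕ,
      ∀ (G : ContextFreeGrammar (Fin m)) [Fintype G.NT],
        G.IsChomskyNormalForm → G.language ≤ letterBoundedWords m →
          ∃ (Q Γ : Type) (_ : Fintype Q) (_ : Fintype Γ) (M : PDA (Fin m) Q Γ),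
            M.IsNormalForm ∧
            M.language = G.language ∧
            M.IsKTurn (m - 1) ∧
            Fintype.card Q ≤ 2 ^ (C * Fintype.card G.NT) ∧
            Fintype.card Γ ≤ K := by
  refine ⟨3, fun m hm => ⟨6 * m + 14, fun G _ hG hL => ?_⟩⟩
  classical
  have hs : ∀ X w, G.Yields G.initial X w → w.Pairwise (· ≤ ·) := fun X w h =>
    mem_letterBoundedWords_iff.mp
      (hL ((ContextFreeGrammar.mem_language_iff_exists_yields hG w).mpr ⟨X, h⟩))
  have hh : 1 ≤ Fintype.card G.NT := Fintype.card_pos_iff.mpr ⟨G.initial⟩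
  set h := Fintype.card G.NT with hh_def
  have hlt : h ≤ 2 ^ h := Nat.lt_two_pow_self.le
  have hNB : 2 ^ (h + 1) ≤ 2 ^ (3 * h) := Nat.pow_le_pow_right (by norm_num) (by omega)
  have hB : h * 2 ^ (h + 1) ≤ 2 ^ (3 * h) := by
    calc h * 2 ^ (h + 1) ≤ 2 ^ h * 2 ^ (h + 1) := Nat.mul_le_mul_right _ hlt
      _ = 2 ^ (h + (h + 1)) := (pow_add 2 h (h + 1)).symm
      _ ≤ 2 ^ (3 * h) := Nat.pow_le_pow_right (by norm_num) (by omega)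
  let L := ContextFreeGrammar.loopSystem G hs hNB
  have hB0 : 0 < 2 ^ (3 * h) := by positivity
  let _ : Fintype (ContextFreeGrammar.SmallTree G (2 ^ (3 * h))) := Fintype.ofFinite _
  let _ : Fintype (LoopSystem.BoundedState m (2 ^ (3 * h))
    (ContextFreeGrammar.SmallTree G (2 ^ (3 * h)))) := Fintype.ofFinite _
  refine ⟨_, StackSymbol, inferInstance, inferInstance, L.toPDA, LoopSystem.isNormalForm_toPDA,
    (LoopSystem.language_toPDA hm hB0).trans
      (ContextFreeGrammar.language_loopSystem hG hs hNB hB),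
    LoopSystem.isKTurn_toPDA hm hB0, ?_, le_rfl⟩
  refine LoopSystem.card_boundedState_le.trans ?_
  have hb : 2 ^ (3 * h) + 1 ≤ 2 ^ (4 * h) := by
    have : 2 ^ (3 * h) * 2 ≤ 2 ^ (4 * h) := by
      rw [← pow_succ]; exact Nat.pow_le_pow_right (by norm_num) (by omega)
    omega
  have hmle : m ≤ 2 ^ (m * h) :=
    Nat.lt_two_pow_self.le.trans (Nat.pow_le_pow_right (by norm_num) (Nat.le_mul_of_pos_right _ hh))
  have hmle' : m + 1 ≤ 2 ^ ((m + 1) * h) :=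
    Nat.lt_two_pow_self.le.trans (Nat.pow_le_pow_right (by norm_num) (Nat.le_mul_of_pos_right _ hh))
  have hcard : Fintype.card (ContextFreeGrammar.SmallTree G (2 ^ (3 * h))) ≤
      2 ^ h * (2 ^ (4 * h)) ^ m :=
    (ContextFreeGrammar.card_smallTree_le _).trans
      (Nat.mul_le_mul_left _ (Nat.pow_le_pow_left hb m))
  calc 2 + 2 * (Fintype.card (ContextFreeGrammar.SmallTree G (2 ^ (3 * h))) *
        (m * ((m + 1) * ((2 ^ (3 * h) + 1) * (2 ^ (3 * h) + 1)))))
      ≤ 2 + 2 * ((2 ^ h * (2 ^ (4 * h)) ^ m) *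
        (2 ^ (m * h) * (2 ^ ((m + 1) * h) * (2 ^ (4 * h) * 2 ^ (4 * h))))) := by gcongr
    _ = 2 + 2 ^ (1 + (h + 4 * h * m + (m * h + ((m + 1) * h + (4 * h + 4 * h))))) := by
      simp only [pow_add, pow_mul, pow_one]
    _ ≤ 2 * 2 ^ (1 + (h + 4 * h * m + (m * h + ((m + 1) * h + (4 * h + 4 * h))))) := by
      have : 2 ^ 1 ≤ 2 ^ (1 + (h + 4 * h * m + (m * h + ((m + 1) * h + (4 * h + 4 * h))))) :=
        Nat.pow_le_pow_right (by norm_num) (by omega)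
      omega
    _ = 2 ^ (1 + (h + 4 * h * m + (m * h + ((m + 1) * h + (4 * h + 4 * h)))) + 1) :=
      (pow_succ' 2 _).symm
    _ ≤ 2 ^ ((6 * m + 14) * h) := Nat.pow_le_pow_right (by norm_num) (by nlinarith)
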